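/- \textbf{Setting.} A finite-horizon MDP has a finite state space $\mathcal X=\mathcal X_1\sqcup\dots\sqcup\mathcal X_H$ (layers), an action space $\mathcal A$, an initial distribution $\rho$ on $\mathcal X_1$, transition probabilities $T(\cdot\mid x,a)$ that lead from $\mathcal X_h$ to $\mathcal X_{h+1}$, and random rewards whose law, a distribution on $[-1,1]$, depends on the current state and action. A policy $\pi$ maps states to distributions on $\mathcal A$; a trajectory $(x_1,a_1,r_1,\dots,x_H,a_H,r_H)$ of $\pi$ is drawn by $x_1\sim\rho$, $a_h\sim\pi(\cdot\mid x_h)$, $r_h\sim r(x_h,a_h)$, $x_{h+1}\sim T(\cdot\mid x_h,a_h)$. Let $Q^\pi(x,a)$, for $x\in\mathcal X_h$, be the expected sum of the rewards in steps $h,\dots,H$ when $a$ is played in $x$ at step $h$ and $\pi$ is followed afterwards; let $V^\pi(x)$ be the same expectation when $\pi$ is followed from $x$ on, and $V^\pi(\rho)=\mathbb E_{x\sim\rho}V^\pi(x)$. Let $d_h^\pi(x,a)=\Pr^\pi(x_h=x)\,\pi(a\mid x)$. The concentrability coefficient of $\pi_{\mathrm e}$ with respect to $\pi_{\mathrm b}$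 is $$\max_{h}\max_{x\in\mathcal X_h,\,a\in\mathcal A}\frac{d_h^{\pi_{\mathrm e}}(x,a)}{d_h^{\pi_{\mathrm b}}(x,a)}\in[0,\infty],\qquad \tfrac00:=0.$$ An offline policy evaluation (OPE) problem is a tuple $\mathfrak g=(M,\pi_{\mathrm e},\pi_{\mathrm b},\mathcal F)$ of an MDP, a deterministic evaluation policy, a behavior policy, and a class $\mathcal F$ of functions $\mathcal X\times\mathcal A\to[-1,1]$. It is realizable if $Q^{\pi_{\mathrm e}}\in\mathcal F$. An algorithm that uses $n$ trajectories receives $\pi_{\mathrm e}$, $\mathcal F$ and $n$ independent trajectories of $\pi_{\mathrm b}$ in $M$ (but not $M$ or $\pi_{\mathrm b}$), and outputs a possibly randomized estimate $\widehat V\in\mathbb R$. \textbf{Theorem.} There are absolute constants $C,c>0$ such that for all $0<\varepsilon\le 1/15$ and every $H\ge 1$ there is a class $\mathfrak G$ of realizable OPE problems with horizon $H$, two actions $\{\mathfrak a_1,\mathfrak a_2\}$ and a common finite layered state space, with the following properties. For every $\mathfrak g=(M,\pi_{\mathrm e},\pi_{\mathrm b},\mathcal F)\in\mathfrak G$ the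 policy $\pi_{\mathrm e}$ always plays $\mathfrak a_1$, $|\mathcal F|=2$, and the concentrability coefficient of $\pi_{\mathrm e}$ with respect to $\pi_{\mathrm b}$ is at most $C H^3$. Moreover, if an algorithm that uses $n$ trajectories satisfies $$\mathbb E_{\mathfrak g}\bigl|\widehat V-V^{\pi_{\mathrm e}}(\rho)\bigr|\le\frac{\varepsilon}{16H}\qquad\text{for every }\mathfrak g\in\mathfrak G,$$ then $n\ge 2^{cH}$. -/

import Mathlib

open scoped ENNReal

noncomputable section

namespace OfflineRL

/-- Rewards take values in `[-1, 1]`. -/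
abbrev Reward : Type := Set.Icc (-1 : ℝ) 1

/-- One time step `(x_h, a_h, r_h)` of an episode. -/
abbrev Step (X A : Type) : Type := X × A × Reward

/-- A complete trajectory `(x_1, a_1, r_1, …, x_H, a_H, r_H)`, indexed by `Fin H`. -/
abbrev Trajectory (X A : Type) (H : ℕ) : Type := Fin H → Step X A

/-- Expectation of a real function under a discrete probability distribution. -/
def expect {α : Type} (p : PMF α) (f : α → ℝ) : ℝ := ∑' ω, (p ω).toReal * f ω

/-- A finite-horizon Markov decision process with action space `A`, horizon `H` and a layered state
space `X`: the `h`-th layer is `{x | layer x = h}`, with layers numbered `0, …, H - 1`. The initial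
distribution is supported on the first layer and transitions lead from each layer to the next one.
Every reward is random, with a distribution on `[-1, 1]` that depends on the current state and
action. (The values of `trans` on the last layer play no role.) -/
structure MDP (X A : Type) (H : ℕ) (layer : X → Fin H) where
  init : PMF X
  trans : X → A → PMF X
  reward : X → A → PMF Reward
  init_layer : ∀ x ∈ init.support, (layer x : ℕ) = 0
  trans_layer : ∀ x a, (layer x : ℕ) + 1 < H →
    ∀ x' ∈ (trans x a).support, (layer x' : ℕ) = layer x + 1

/-- A (Markov, randomized) policy. As the state space is layered, the policy may depend on the
time step through the state. -/
abbrev Policy (X A : Type) : Type := X → PMF A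

/-- The randomized policy that always plays the action of a deterministic policy. -/
def detPolicy {X A : Type} (π : X → A) : Policy X A := fun x => PMF.pure (π x)

namespace MDP

variable {X A : Type} {H : ℕ} {layer : X → Fin H}

/-- The law of the next `k` steps of the process that is in state `x`, first plays `a`, and plays
according to `π` afterwards. -/
def rollout (M : MDP X A H layer) (π : Policy X A) :
    (k : ℕ) → X → A → PMF (Fin k → Step X A)
  | 0, _, _ => PMF.pure Fin.elim0
  | k + 1, x, a =>
    (M.reward x a).bind fun r =>
      (M.trans x a).bind fun x' =>
        (π x').bind fun a' =>
          (M.rollout π k x' a').map fun τ => (Fin.cons (x, a, r) τ : Fin (k + 1) → Step X A)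

/-- The law of a complete trajectory under the policy `π`: the first state is drawn from the
initial distribution and all actions are drawn from `π`. -/
def trajectoryLaw (M : MDP X A H layer) (π : Policy X A) : PMF (Trajectory X A H) :=
  M.init.bind fun x => (π x).bind fun a => M.rollout π H x a

/-- The state occupancy measure `d_h^π(x) = P(x_h = x)`. -/
def stateOccupancy (M : MDP X A H layer) (π : Policy X A) (h : Fin H) (x : X) : ℝ≥0∞ :=
  ((M.trajectoryLaw π).map fun τ => (τ h).1) x

/-- The state-action occupancy measure `d_h^π(x, a) = d_h^π(x) π(a | x)`. -/
def occupancy (M : MDP X A H layer) (π : Policy X A) (h : Fin H) (x : X) (a : A) : ℝ≥0∞ :=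
  M.stateOccupancy π h x * π x a

/-- The sum of the rewards in a sequence of steps. -/
def totalReward {k : ℕ} (τ : Fin k → Step X A) : ℝ := ∑ i, ((τ i).2.2 : ℝ)

/-- The state-action value function `Q^π(x, a)`: the expected sum of the rewards from the time step
of `x` to the end of the episode, when `a` is played in `x` and `π` is followed afterwards. -/
def actionValue (M : MDP X A H layer) (π : Policy X A) (x : X) (a : A) : ℝ :=
  expect (M.rollout π (H - layer x) x a) totalReward

/-- The state value function `V^π(x)`. -/
def stateValue (M : MDP X A H layer) (π : Policy X A) (x : X) : ℝ :=
  expect ((π x).bind fun a => M.rollout π (H - layer x) x a) totalReward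

/-- The value `V^π(ρ) = E_{x ∼ ρ} V^π(x)` of a policy, where `ρ` is the initial distribution. -/
def value (M : MDP X A H layer) (π : Policy X A) : ℝ := expect M.init (M.stateValue π)

/-- The concentrability coefficient of `π` with respect to `π'`: the maximum over `h`, `x`, `a` of
`d_h^π(x, a) / d_h^π'(x, a)`. It is computed in `[0, ∞]`, where `0 / 0 = 0` and `t / 0 = ∞` for
`t > 0`. -/
def concentrability (M : MDP X A H layer) (π π' : Policy X A) : ℝ≥0∞ :=
  ⨆ (h : Fin H) (x : X) (a : A), M.occupancy π h x a / M.occupancy π' h x a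

end MDP

/-- An offline policy evaluation problem: an MDP, a deterministic evaluation policy, a policy that
generates the offline trajectories, and a class of functions `X × A → [-1, 1]`. -/
structure OPEProblem (X A : Type) (H : ℕ) (layer : X → Fin H) where
  mdp : MDP X A H layer
  evalPolicy : X → A
  behaviorPolicy : Policy X A
  funClass : Set (X → A → ℝ)
  funClass_bounded : ∀ f ∈ funClass, ∀ x a, f x a ∈ Set.Icc (-1 : ℝ) 1

/-- An offline policy evaluation algorithm that uses `n` trajectories. It is given the evaluation
policy, the function class and a data set of `n` trajectories, and returns an estimate, possibly
with the help of internal randomness: its output is the law of the estimate given the input. The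
data are discrete, so that no measurability in the data is required. -/
abbrev OPEAlgorithm (X A : Type) (H n : ℕ) : Type :=
  (X → A) → Set (X → A → ℝ) → (Fin n → Trajectory X A H) → MeasureTheory.ProbabilityMeasure ℝ

namespace OPEProblem

variable {X A : Type} {H : ℕ} {layer : X → Fin H}

/-- The function class contains the state-action value function of the evaluation policy. -/
def Realizable (g : OPEProblem X A H layer) : Prop :=
  g.mdp.actionValue (detPolicy g.evalPolicy) ∈ g.funClass

/-- The value of the evaluation policy, which is to be estimated. -/
def target (g : OPEProblem X A H layer) : ℝ := g.mdp.value (detPolicy g.evalPolicy)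

/-- The concentrability coefficient of the evaluation policy with respect to the behavior policy. -/
def concentrability (g : OPEProblem X A H layer) : ℝ≥0∞ :=
  g.mdp.concentrability (detPolicy g.evalPolicy) g.behaviorPolicy

/-- The expected absolute error of an algorithm whose data set consists of `n` independent
trajectories of the behavior policy. -/
def expectedError (g : OPEProblem X A H layer) {n : ℕ} (alg : OPEAlgorithm X A H n) : ℝ≥0∞ :=
  ∑' D : Fin n → Trajectory X A H,
    (∏ i, g.mdp.trajectoryLaw g.behaviorPolicy (D i)) *
      ∫⁻ v, ENNReal.ofReal |v - g.target|
        ∂(alg g.evalPolicy g.funClass D : MeasureTheory.Measure ℝ)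

end OPEProblem

end OfflineRL

end

/-! Hidden labels hide the sign of the value. Every layer has `N` pairs of observations, and a
hidden bit per pair decides which member is bad (label `true`) and which is good. Let σ be the sign,
p the `slip` and g_h the `gap`. Before the last layer, the first action leads from a good
observation to a terminal reward ±1 of mean σ g_h. From a bad one it does so only with probability p
and with the opposite mean -σ g_h, and otherwise leads to a uniform observation of the next layer.
Since (1 - p) g_{h+1} - p g_h = g_h, both kinds have value σ g_h: the action value depends on σ
alone, and two functions suffice for realizability (`actionValue_eq`).

The behavior policy plays the first action always in bad observations and with probability p in good
ones. If the label is a fair coin, the exits to ±1 then have weights p(1 ± σ g_h)/2 from good and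
p(1 ∓ σ g_h)/2 from bad observations, and the sum is free of σ (`behaviorLaw_mul_kindLaw_sum`).
Hence, averaged over the hidden bits, a data set is equally likely under both signs
(`sum_prod_dataLaw_eq`), unless a bit is read twice or the first action is played in an observation
of the last layer, where the reward shows σ. A large `N` makes the former rare; the latter has
probability of order 2^{-H} per trajectory, because half of the observations of each layer are good
and end the chain (`stateLaw_observation_le`).

Concentrability stays linear in H nevertheless: observations are reached only through bad ones,
where both policies play the same action, so the ratios do not multiply up, and 1/p = 2H + 1 is a
bound (`concentrability_problem_le`).

The values ±1/3 are 2/3 apart, so a two-point argument (`le_two_mul_error`) forces an error of at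
least 1/12 on some problem, far above ε/(16H). The class does not depend on ε. -/

noncomputable section

namespace OfflineRL

/-! ### Expectations and pushforwards of discrete laws -/

section Expect

variable {α β : Type}

theorem expect_pure (a : α) (f : α → ℝ) : expect (PMF.pure a) f = f a := by
  unfold expect
  rw [tsum_eq_single a]
  · simp
  · intro b hb
    simp [PMF.pure_apply_of_ne _ _ hb]

theorem summable_toReal_pmf (p : PMF α) : Summable fun a => (p a).toReal :=
  ENNReal.summable_toReal p.tsum_coe_ne_top

theorem tsum_toReal_pmf (p : PMF α) : ∑' a, (p a).toReal = 1 := by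
  rw [← ENNReal.tsum_toReal_eq fun a => p.apply_ne_top a, p.tsum_coe, ENNReal.toReal_one]

theorem summable_toReal_mul (p : PMF α) {f : α → ℝ} {B : ℝ} (hf : ∀ a, |f a| ≤ B) :
    Summable fun a => (p a).toReal * f a := by
  refine Summable.of_norm_bounded (g := fun a => (p a).toReal * B)
    ((summable_toReal_pmf p).mul_right B) fun a => ?_
  rw [Real.norm_eq_abs, abs_mul, abs_of_nonneg ENNReal.toReal_nonneg]
  exact mul_le_mul_of_nonneg_left (hf a) ENNReal.toReal_nonneg

/-- Boundedness of `f` makes the double series absolutely summable, which permits exchanging the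
sums. -/
theorem expect_bind (p : PMF α) (q : α → PMF β) {f : β → ℝ} {B : ℝ} (hf : ∀ b, |f b| ≤ B) :
    expect (p.bind q) f = expect p fun a => expect (q a) f := by
  have hqs : ∀ a, Summable fun b => (q a b).toReal := fun a => summable_toReal_pmf (q a)
  have hsum : Summable fun z : α × β => (p z.1).toReal * (q z.1 z.2).toReal := by
    have h0 : 0 ≤ fun z : α × β => (p z.1).toReal * (q z.1 z.2).toReal := fun z =>
      mul_nonneg ENNReal.toReal_nonneg ENNReal.toReal_nonneg
    refine (summable_prod_of_nonneg h0).2 ?_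
    refine ⟨fun a => (hqs a).mul_left (p a).toReal, ?_⟩
    simp only [tsum_mul_left, tsum_toReal_pmf, mul_one]
    exact summable_toReal_pmf p
  have hsumf : Summable fun z : α × β => (p z.1).toReal * ((q z.1 z.2).toReal * f z.2) := by
    refine Summable.of_norm_bounded (g := fun z : α × β =>
      (p z.1).toReal * (q z.1 z.2).toReal * B) (hsum.mul_right B) fun z => ?_
    rw [← mul_assoc, Real.norm_eq_abs, abs_mul,
      abs_of_nonneg (mul_nonneg ENNReal.toReal_nonneg ENNReal.toReal_nonneg)]
    exact mul_le_mul_of_nonneg_left (hf z.2)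
      (mul_nonneg ENNReal.toReal_nonneg ENNReal.toReal_nonneg)
  unfold expect
  calc ∑' b, ((p.bind q) b).toReal * f b
      = ∑' b, ∑' a, (p a).toReal * ((q a b).toReal * f b) := by
        refine tsum_congr fun b => ?_
        rw [PMF.bind_apply, ENNReal.tsum_toReal_eq fun a =>
          ENNReal.mul_ne_top (p.apply_ne_top a) ((q a).apply_ne_top b), ← tsum_mul_right]
        refine tsum_congr fun a => ?_
        rw [ENNReal.toReal_mul, mul_assoc]
    _ = ∑' a, ∑' b, (p a).toReal * ((q a b).toReal * f b) :=
        Summable.tsum_comm (f := fun a b => (p a).toReal * ((q a b).toReal * f b)) hsumf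
    _ = ∑' a, (p a).toReal * ∑' b, (q a b).toReal * f b := by simp_rw [tsum_mul_left]

theorem expect_map (p : PMF α) (g : α → β) {f : β → ℝ} {B : ℝ} (hf : ∀ b, |f b| ≤ B) :
    expect (p.map g) f = expect p (f ∘ g) := by
  rw [← PMF.bind_pure_comp, expect_bind p _ hf]
  simp [expect_pure, Function.comp_def]

theorem expect_const_add (p : PMF α) (c : ℝ) {f : α → ℝ} {B : ℝ} (hf : ∀ a, |f a| ≤ B) :
    expect p (fun a => c + f a) = c + expect p f := by
  unfold expect
  simp_rw [mul_add]
  rw [Summable.tsum_add ((summable_toReal_pmf p).mul_right c) (summable_toReal_mul p hf),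
    tsum_mul_right, tsum_toReal_pmf, one_mul]

theorem tsum_map_mul (p : PMF α) (g : α → β) (f : β → ℝ≥0∞) :
    ∑' b, p.map g b * f b = ∑' a, p a * f (g a) := by
  classical
  simp_rw [PMF.map_apply, ← ENNReal.tsum_mul_right]
  rw [ENNReal.tsum_comm]
  refine tsum_congr fun a => ?_
  rw [tsum_eq_single (g a)]
  · simp
  · intro b hb
    simp [hb]

theorem map_prodMk_apply {γ : Type} [DecidableEq γ] (p : PMF α) (c : γ) (x : γ × α) :
    p.map (Prod.mk c) x = if x.1 = c then p x.2 else 0 := by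
  classical
  obtain ⟨c', a⟩ := x
  rw [PMF.map_apply]
  by_cases h : c' = c
  · subst h
    rw [tsum_eq_single a]
    · simp
    · intro b hb
      simp [Ne.symm hb]
  · simp [h]

end Expect

/-! ### Sums over independent samples and over independent bits -/

section ProductSums

variable {T : Type}

theorem tsum_pi_prod (n : ℕ) (f : Fin n → T → ℝ≥0∞) :
    ∑' D : Fin n → T, ∏ i, f i (D i) = ∏ i, ∑' t, f i t := by
  induction n with
  | zero => simp [tsum_fintype]
  | succ n ih =>
    rw [← (Fin.consEquiv fun _ : Fin (n + 1) => T).tsum_eq, ENNReal.tsum_prod']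
    simp only [Fin.consEquiv, Equiv.coe_fn_mk, Fin.prod_univ_succ, Fin.cons_zero, Fin.cons_succ,
      ENNReal.tsum_mul_left, ENNReal.tsum_mul_right]
    rw [ih]

theorem tsum_prod_pmf (n : ℕ) (p : PMF T) : ∑' D : Fin n → T, ∏ i, p (D i) = 1 := by
  rw [tsum_pi_prod n fun _ => p]
  simp

theorem tsum_prod_pmf_mul (n : ℕ) (p : PMF T) (i : Fin n) (f : T → ℝ≥0∞) :
    ∑' D : Fin n → T, (∏ k, p (D k)) * f (D i) = ∑' t, p t * f t := by
  classical
  have h : ∀ D : Fin n → T, (∏ k, p (D k)) * f (D i) =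
      ∏ k, p (D k) * (if k = i then f (D k) else 1) := fun D => by
    rw [Finset.prod_mul_distrib, Finset.prod_ite_eq' Finset.univ i]
    simp
  simp_rw [h]
  rw [tsum_pi_prod n fun k t => p t * (if k = i then f t else 1),
    Finset.prod_eq_single i]
  · simp
  · intro k _ hk
    simp [hk]
  · simp

theorem tsum_prod_pmf_mul_mul (n : ℕ) (p : PMF T) {i j : Fin n} (hij : i ≠ j)
    (f g : T → ℝ≥0∞) :
    ∑' D : Fin n → T, (∏ k, p (D k)) * (f (D i) * g (D j)) =
      (∑' t, p t * f t) * ∑' t, p t * g t := by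
  classical
  have h : ∀ D : Fin n → T, (∏ k, p (D k)) * (f (D i) * g (D j)) =
      ∏ k, p (D k) * ((if k = i then f (D k) else 1) * (if k = j then g (D k) else 1)) := fun D => by
    rw [Finset.prod_mul_distrib, Finset.prod_mul_distrib, Finset.prod_ite_eq' Finset.univ i,
      Finset.prod_ite_eq' Finset.univ j]
    simp
  simp_rw [h]
  rw [tsum_pi_prod n fun k t =>
      p t * ((if k = i then f t else 1) * (if k = j then g t else 1)),
    ← Finset.mul_prod_erase Finset.univ _ (Finset.mem_univ i),
    ← Finset.mul_prod_erase _ _ (Finset.mem_erase.2 ⟨hij.symm, Finset.mem_univ j⟩),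
    Finset.prod_eq_one]
  · simp [hij, hij.symm]
  · intro k hk
    simp only [Finset.mem_erase, Finset.mem_univ, and_true] at hk
    simp [hk.1, hk.2]

/-- Two products that read independent uniform bits at distinct places have the same average as soon
as their factors have the same averages. -/
theorem sum_prod_comp_eq {I J : Type} [Fintype I] [Fintype J] [DecidableEq I] [DecidableEq J]
    (S : Finset I) (e : I → J) (he : Set.InjOn e S) (g g' : I → Bool → ℝ≥0∞)
    (hS : ∀ i ∈ S, ∑ b, g i b = ∑ b, g' i b)
    (hSc : ∀ i ∉ S, ∀ b, g i b = g' i b ∧ g i b = g i true) :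
    ∑ θ : J → Bool, ∏ i, g i (θ (e i)) = ∑ θ : J → Bool, ∏ i, g' i (θ (e i)) := by
  -- Grouping the factors by the bit they read factorizes the sum over `θ`; injectivity on `S` will
  -- leave at most one factor per bit.
  have key : ∀ u : I → Bool → ℝ≥0∞, ∑ θ : J → Bool, ∏ i ∈ S, u i (θ (e i)) =
      ∏ j, ∑ b, ∏ i ∈ S with e i = j, u i b := fun u => by
    rw [Finset.prod_univ_sum, Fintype.piFinset_univ]
    refine Finset.sum_congr rfl fun θ _ => ?_
    rw [← Finset.prod_fiberwise S e]
    refine Finset.prod_congr rfl fun j _ => Finset.prod_congr rfl fun i hi => ?_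
    rw [(Finset.mem_filter.1 hi).2]
  have hsplit : ∀ u : I → Bool → ℝ≥0∞, (∀ i ∉ S, ∀ b, u i b = g i true) →
      ∑ θ : J → Bool, ∏ i, u i (θ (e i)) =
        (∑ θ : J → Bool, ∏ i ∈ S, u i (θ (e i))) * ∏ i ∈ Sᶜ, g i true := fun u hu => by
    rw [Finset.sum_mul]
    refine Finset.sum_congr rfl fun θ _ => ?_
    rw [← Finset.prod_mul_prod_compl S]
    congr 1
    exact Finset.prod_congr rfl fun i hi => hu i (Finset.mem_compl.1 hi) _
  rw [hsplit g fun i hi b => (hSc i hi b).2,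
    hsplit g' fun i hi b => (hSc i hi b).1.symm.trans (hSc i hi b).2, key, key]
  congr 1
  refine Finset.prod_congr rfl fun j _ => ?_
  rcases (S.filter fun i => e i = j).eq_empty_or_nonempty with h | ⟨i, hi⟩
  · simp [h]
  · have hiS := Finset.mem_filter.1 hi
    have h : (S.filter fun i => e i = j) = {i} := by
      refine Finset.eq_singleton_iff_unique_mem.2 ⟨hi, fun k hk => ?_⟩
      rw [Finset.mem_filter] at hk
      exact he hk.1 hiS.1 (hk.2.trans hiS.2.symm)
    simpa [h] using hS i hiS.1

end ProductSums

namespace MDP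

variable {X A : Type} {H : ℕ} {layer : X → Fin H}

/-! ### Bellman equation -/

section Value

theorem abs_totalReward_le {k : ℕ} (τ : Fin k → Step X A) : |totalReward τ| ≤ k := by
  unfold totalReward
  refine (Finset.abs_sum_le_sum_abs _ _).trans ?_
  refine (Finset.sum_le_sum fun i _ => abs_le.2 (τ i).2.2.2).trans ?_
  simp

theorem totalReward_cons {k : ℕ} (s : Step X A) (τ : Fin k → Step X A) :
    totalReward (Fin.cons s τ : Fin (k + 1) → Step X A) = s.2.2 + totalReward τ := by
  simp [totalReward, Fin.sum_univ_succ]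

theorem expect_rollout_zero (M : MDP X A H layer) (π : Policy X A) (x : X) (a : A) :
    expect (M.rollout π 0 x a) totalReward = 0 := by
  rw [rollout, expect_pure]
  simp [totalReward]

/-- The Bellman equation for deterministic policies and deterministic rewards. -/
theorem expect_rollout_succ (M : MDP X A H layer) (π : X → A) (k : ℕ) (x : X) (a : A) (r : Reward)
    (hr : M.reward x a = PMF.pure r) :
    expect (M.rollout (detPolicy π) (k + 1) x a) totalReward =
      r + expect (M.trans x a) fun x' =>
        expect (M.rollout (detPolicy π) k x' (π x')) totalReward := by
  have hE : ∀ x', |expect (M.rollout (detPolicy π) k x' (π x')) totalReward| ≤ k := fun x' => by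
    unfold expect
    have hs := summable_toReal_mul (M.rollout (detPolicy π) k x' (π x'))
      (f := totalReward) abs_totalReward_le
    rw [← Real.norm_eq_abs]
    refine (norm_tsum_le_tsum_norm hs.norm).trans ?_
    calc ∑' τ, ‖((M.rollout (detPolicy π) k x' (π x')) τ).toReal * totalReward τ‖
        ≤ ∑' τ, ((M.rollout (detPolicy π) k x' (π x')) τ).toReal * (k : ℝ) := by
          refine Summable.tsum_le_tsum (fun τ => ?_) hs.norm
            ((summable_toReal_pmf _).mul_right _)
          rw [Real.norm_eq_abs, abs_mul, abs_of_nonneg ENNReal.toReal_nonneg]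
          exact mul_le_mul_of_nonneg_left (abs_totalReward_le τ) ENNReal.toReal_nonneg
      _ = k := by rw [tsum_mul_right, tsum_toReal_pmf, one_mul]
  simp only [rollout, hr, PMF.pure_bind, detPolicy]
  rw [expect_bind _ _ abs_totalReward_le, ← expect_const_add _ _ hE]
  congr 1
  funext x'
  rw [expect_map _ _ abs_totalReward_le, ← expect_const_add _ _ abs_totalReward_le]
  congr 1
  funext τ
  simp [totalReward_cons]

theorem value_detPolicy (M : MDP X A H layer) (π : X → A) :
    M.value (detPolicy π) = expect M.init fun x => M.actionValue (detPolicy π) x (π x) := by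
  unfold value
  congr 1
  funext x
  simp [stateValue, actionValue, detPolicy]

end Value

/-! ### State laws as marginals of the trajectory law -/

section Occupancy

/-- The law of the next state when the current action is drawn from `π`. -/
def stepLaw (M : MDP X A H layer) (π : Policy X A) (x : X) : PMF X := (π x).bind (M.trans x)

/-- The law of the state after `i` steps from a given state. -/
def stateAfter (M : MDP X A H layer) (π : Policy X A) : ℕ → X → PMF X
  | 0, x => PMF.pure x
  | i + 1, x => (M.stepLaw π x).bind (M.stateAfter π i)

/-- The law of the state at time `h`. -/
def stateLaw (M : MDP X A H layer) (π : Policy X A) : ℕ → PMF X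
  | 0 => M.init
  | h + 1 => (M.stateLaw π h).bind (M.stepLaw π)

theorem stateAfter_succ' (M : MDP X A H layer) (π : Policy X A) (i : ℕ) (x : X) :
    M.stateAfter π (i + 1) x = (M.stateAfter π i x).bind (M.stepLaw π) := by
  induction i generalizing x with
  | zero =>
    rw [stateAfter, stateAfter, PMF.pure_bind]
    exact PMF.bind_pure _
  | succ i ih =>
    rw [stateAfter, stateAfter, PMF.bind_bind]
    congr 1
    funext y
    exact ih y

theorem stateLaw_eq_bind (M : MDP X A H layer) (π : Policy X A) (h : ℕ) :
    M.stateLaw π h = M.init.bind (M.stateAfter π h) := by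
  induction h with
  | zero => exact (PMF.bind_pure _).symm
  | succ h ih =>
    rw [stateLaw, ih, PMF.bind_bind]
    congr 1
    funext x
    exact (M.stateAfter_succ' π h x).symm

/-- The rewards and everything drawn after step `i` integrate out, which leaves the Markov chain of
`stepLaw`. -/
theorem rollout_map_step (M : MDP X A H layer) (π : Policy X A) (k : ℕ) (i : Fin k) (x : X) :
    ((π x).bind fun a => (M.rollout π k x a).map fun τ => ((τ i).1, (τ i).2.1)) =
      (M.stateAfter π i x).bind fun y => (π y).map (Prod.mk y) := by
  induction k generalizing x with
  | zero => exact i.elim0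
  | succ k ih =>
    simp only [rollout, PMF.map_bind, PMF.map_comp]
    refine Fin.cases ?_ (fun i => ?_) i
    · simp only [Function.comp_def, Fin.cons_zero, Fin.val_zero, stateAfter, PMF.pure_bind,
        PMF.bind_const]
      rw [← PMF.bind_pure_comp]
      congr 1
      funext a
      have h : ∀ p : PMF (Fin k → Step X A), p.map (fun _ => (x, a)) = PMF.pure (x, a) :=
        fun p => PMF.map_const p (x, a)
      simp [h]
    · simp only [Function.comp_def, Fin.cons_succ, Fin.val_succ, stateAfter, PMF.bind_const, ih]
      rw [stepLaw, PMF.bind_bind, PMF.bind_bind]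

theorem trajectoryLaw_map_step (M : MDP X A H layer) (π : Policy X A) (h : Fin H) :
    ((M.trajectoryLaw π).map fun τ => ((τ h).1, (τ h).2.1)) =
      (M.stateLaw π h).bind fun y => (π y).map (Prod.mk y) := by
  rw [trajectoryLaw, PMF.map_bind, stateLaw_eq_bind, PMF.bind_bind]
  congr 1
  funext x
  rw [PMF.map_bind, rollout_map_step]

theorem trajectoryLaw_map_state (M : MDP X A H layer) (π : Policy X A) (h : Fin H) :
    ((M.trajectoryLaw π).map fun τ => (τ h).1) = M.stateLaw π h := by
  have h1 : ((M.trajectoryLaw π).map fun τ => (τ h).1) =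
      ((M.trajectoryLaw π).map fun τ => ((τ h).1, (τ h).2.1)).map Prod.fst := by
    rw [PMF.map_comp]
    rfl
  rw [h1, trajectoryLaw_map_step, PMF.map_bind]
  have h2 : ∀ y, ((π y).map (Prod.mk y)).map Prod.fst = PMF.pure y := fun y => by
    rw [PMF.map_comp]
    exact PMF.map_const _ y
  simp_rw [h2]
  exact PMF.bind_pure _

theorem stateOccupancy_eq (M : MDP X A H layer) (π : Policy X A) (h : Fin H) (x : X) :
    M.stateOccupancy π h x = M.stateLaw π h x := by
  rw [stateOccupancy, trajectoryLaw_map_state]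

theorem stateLaw_succ_apply (M : MDP X A H layer) (π : Policy X A) (h : ℕ) (y : X) :
    M.stateLaw π (h + 1) y = ∑' x, M.stateLaw π h x * ∑' a, π x a * M.trans x a y := rfl

theorem tsum_trajectoryLaw_mul_state (M : MDP X A H layer) (π : Policy X A) (h : Fin H)
    (f : X → ℝ≥0∞) :
    ∑' τ, M.trajectoryLaw π τ * f (τ h).1 = ∑' x, M.stateLaw π h x * f x := by
  rw [← trajectoryLaw_map_state, tsum_map_mul]

theorem tsum_trajectoryLaw_mul_step (M : MDP X A H layer) (π : Policy X A) (h : Fin H)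
    (f : X × A → ℝ≥0∞) :
    ∑' τ, M.trajectoryLaw π τ * f ((τ h).1, (τ h).2.1) =
      ∑' x, M.stateLaw π h x * ∑' a, π x a * f (x, a) := by
  rw [← tsum_map_mul _ (fun τ : Trajectory X A H => ((τ h).1, (τ h).2.1)), trajectoryLaw_map_step]
  simp_rw [PMF.bind_apply, ← ENNReal.tsum_mul_right]
  rw [ENNReal.tsum_comm]
  refine tsum_congr fun x => ?_
  simp_rw [mul_assoc]
  rw [ENNReal.tsum_mul_left, tsum_map_mul]

end Occupancy

/-! ### Product formula for the probability of a trajectory -/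

section Density

/-- The probability of the action, the reward and the next state at time `i` of a trajectory. -/
def stepWeight (M : MDP X A H layer) (π : Policy X A) {k : ℕ} (τ : Fin k → Step X A)
    (i : Fin k) : ℝ≥0∞ :=
  π (τ i).1 (τ i).2.1 * M.reward (τ i).1 (τ i).2.1 (τ i).2.2 *
    if h : (i : ℕ) + 1 < k then M.trans (τ i).1 (τ i).2.1 (τ ⟨i + 1, h⟩).1 else 1

theorem stepWeight_succ (M : MDP X A H layer) (π : Policy X A) {k : ℕ}
    (τ : Fin (k + 1) → Step X A) (i : Fin k) :
    M.stepWeight π τ i.succ = M.stepWeight π (Fin.tail τ) i := by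
  simp only [stepWeight, Fin.tail, Fin.val_succ, Nat.add_lt_add_iff_right]
  rfl

theorem map_cons_apply {B : Type} [DecidableEq B] {k : ℕ} (s : B) (p : PMF (Fin k → B))
    (τ : Fin (k + 1) → B) :
    p.map (fun τ' => (Fin.cons s τ' : Fin (k + 1) → B)) τ =
      if τ 0 = s then p (Fin.tail τ) else 0 := by
  classical
  rw [PMF.map_apply]
  have h : ∀ τ', τ = (Fin.cons s τ' : Fin (k + 1) → B) ↔ τ 0 = s ∧ Fin.tail τ = τ' := fun τ' => by
    constructor
    · rintro rfl
      simp
    · rintro ⟨rfl, rfl⟩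
      exact (Fin.cons_self_tail τ).symm
  simp_rw [h]
  by_cases h0 : τ 0 = s
  · simp only [h0, true_and, if_true]
    rw [tsum_eq_single (Fin.tail τ)]
    · simp
    · intro b hb
      simp [hb.symm]
  · simp [h0]

theorem play_succ_apply (M : MDP X A H layer) (π : Policy X A) (k : ℕ) (x : X)
    (τ : Fin (k + 1) → Step X A) [Decidable ((τ 0).1 = x)] :
    ((π x).bind fun a => M.rollout π (k + 1) x a) τ =
      if (τ 0).1 = x then
        π x (τ 0).2.1 * (M.reward x (τ 0).2.1 (τ 0).2.2 *
          ∑' x', M.trans x (τ 0).2.1 x' *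
            ((π x').bind fun a => M.rollout π k x' a) (Fin.tail τ))
      else 0 := by
  classical
  have hcond : ∀ a r, τ 0 = (x, a, r) ↔ (τ 0).1 = x ∧ a = (τ 0).2.1 ∧ r = (τ 0).2.2 := fun a r => by
    rw [Prod.ext_iff, Prod.ext_iff]
    simp only
    tauto
  simp only [rollout, PMF.bind_apply, map_cons_apply, hcond]
  by_cases hx : (τ 0).1 = x
  · simp only [hx, true_and, if_true]
    rw [tsum_eq_single (τ 0).2.1]
    · congr 1
      rw [tsum_eq_single (τ 0).2.2]
      · simp
      · intro r hr
        simp [hr]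
    · intro a ha
      simp [ha]
  · simp [hx]

theorem play_apply (M : MDP X A H layer) (π : Policy X A) (k : ℕ) (x : X)
    (τ : Fin (k + 1) → Step X A) [Decidable ((τ 0).1 = x)] :
    ((π x).bind fun a => M.rollout π (k + 1) x a) τ =
      if (τ 0).1 = x then ∏ i, M.stepWeight π τ i else 0 := by
  classical
  induction k generalizing x with
  | zero =>
    rw [play_succ_apply]
    split_ifs with hx
    · subst hx
      -- `rollout` draws one more state and action than it records. They integrate to one, hence the
      -- factor `1` at the last index in `stepWeight`.
      have h : ∀ x', ((π x').bind fun a => M.rollout π 0 x' a) (Fin.tail τ) = 1 := fun x' => by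
        simp [rollout, PMF.bind_const, PMF.pure_apply, eq_iff_true_of_subsingleton]
      simp [h, stepWeight]
    · rfl
  | succ k ih =>
    rw [play_succ_apply]
    split_ifs with hx
    · subst hx
      simp_rw [ih, Fin.prod_univ_succ (fun i => M.stepWeight π τ i), stepWeight_succ]
      rw [tsum_eq_single (Fin.tail τ 0).1]
      · rw [stepWeight, dif_pos (by simp)]
        simp only [if_true]
        rw [← mul_assoc, ← mul_assoc]
        rfl
      · intro x' hx'
        simp [hx'.symm]
    · rfl

theorem trajectoryLaw_apply {K : ℕ} {layer : X → Fin (K + 1)} (M : MDP X A (K + 1) layer)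
    (π : Policy X A) (τ : Trajectory X A (K + 1)) :
    M.trajectoryLaw π τ = M.init (τ 0).1 * ∏ i, M.stepWeight π τ i := by
  classical
  rw [trajectoryLaw, PMF.bind_apply]
  simp_rw [play_apply]
  rw [tsum_eq_single (τ 0).1]
  · simp
  · intro x hx
    simp [hx.symm]

end Density

theorem layer_of_stateLaw_ne_zero (M : MDP X A H layer) (π : Policy X A) (h : ℕ) (hh : h < H)
    (x : X) (hx : M.stateLaw π h x ≠ 0) : (layer x : ℕ) = h := by
  induction h generalizing x with
  | zero => exact M.init_layer x ((PMF.mem_support_iff _ _).2 hx)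
  | succ h ih =>
    rw [stateLaw_succ_apply] at hx
    obtain ⟨y, hy⟩ := not_forall.1 (mt ENNReal.tsum_eq_zero.2 hx)
    obtain ⟨hy1, hy2⟩ := mul_ne_zero_iff.1 hy
    obtain ⟨a, ha⟩ := not_forall.1 (mt ENNReal.tsum_eq_zero.2 hy2)
    have hly := ih (by omega) y hy1
    rw [M.trans_layer y a (by omega) x ((PMF.mem_support_iff _ _).2 (mul_ne_zero_iff.1 ha).2), hly]

end MDP

namespace HardInstance

/-! ### Numerical parameters of the hard instance -/

section Parameters

/-- The probability with which the informative action is played in a good observation, and with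
which the chain is left from a bad one. -/
def slip (K : ℕ) : ℝ := 1 / (2 * (K + 1) + 1)

/-- The absolute value of the evaluation policy at the observations of layer `h`. -/
def gap (K h : ℕ) : ℝ := 1 / 3 * (1 + 1 / ((K : ℝ) + 1)) ^ h

/-- The sign encoded by a Boolean. -/
def sgn (s : Bool) : ℝ := if s then 1 else -1

theorem slip_pos (K : ℕ) : 0 < slip K := by unfold slip; positivity

theorem slip_le (K : ℕ) : slip K ≤ 1 / 3 := by
  unfold slip
  have : (0 : ℝ) ≤ K := K.cast_nonneg
  exact one_div_le_one_div_of_le (by norm_num) (by linarith)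

theorem slip_le_one (K : ℕ) : slip K ≤ 1 := (slip_le K).trans (by norm_num)

theorem gap_pos (K h : ℕ) : 0 < gap K h := by unfold gap; positivity

theorem gap_zero (K : ℕ) : gap K 0 = 1 / 3 := by simp [gap]

/-- The growth over all layers is at most (1 + 1/H)^H ≤ e < 3; the prefactor 1/3 in `gap`
compensates it. -/
theorem gap_le_one (K h : ℕ) (hh : h ≤ K + 1) : gap K h ≤ 1 := by
  have h1 : (1 + 1 / ((K : ℝ) + 1)) ^ h ≤ 3 := by
    calc (1 + 1 / ((K : ℝ) + 1)) ^ h ≤ (1 + 1 / ((K : ℝ) + 1)) ^ (K + 1) :=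
          pow_le_pow_right₀ (by linarith [show 0 ≤ 1 / ((K : ℝ) + 1) by positivity]) hh
      _ ≤ Real.exp (1 / ((K : ℝ) + 1)) ^ (K + 1) :=
          pow_le_pow_left₀ (by positivity)
            (by linarith [Real.add_one_le_exp (1 / ((K : ℝ) + 1))]) _
      _ = Real.exp 1 := by
          rw [← Real.exp_nat_mul]
          congr 1
          push_cast
          field_simp
      _ ≤ 3 := by linarith [Real.exp_one_lt_d9]
  unfold gap
  linarith

/-- This is the Bellman equation at bad observations. The choice p = 1/(2H + 1) gives (1 + p)/(1 -
p) = 1 + 1/H, the growth rate of `gap`. -/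
theorem gap_succ (K h : ℕ) : (1 - slip K) * gap K (h + 1) = (1 + slip K) * gap K h := by
  unfold gap slip
  rw [pow_succ]
  field_simp
  ring

theorem abs_sgn_mul_gap_le (K : ℕ) (s : Bool) (h : Fin (K + 1)) : |sgn s * gap K h| ≤ 1 := by
  rw [abs_mul, abs_of_pos (gap_pos K h)]
  cases s <;> simpa [sgn] using gap_le_one K h h.2.le

end Parameters

/-! ### Transition and action laws -/

section Kernels

/-- The part of a state inside its layer: one of `2 N` observations, which come in pairs, or one
of the three terminal states with rewards `0`, `1` and `-1`. -/
abbrev Kind (N : ℕ) : Type := (Fin N × Bool) ⊕ Fin 3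

/-- The layered state space. -/
abbrev State (K N : ℕ) : Type := Fin (K + 1) × Kind N

/-- The reward of a terminal state. -/
def terminalReward (z : Fin 3) : ℝ := ![0, 1, -1] z

theorem abs_terminalReward_le (z : Fin 3) : |terminalReward z| ≤ 1 := by
  fin_cases z <;> simp [terminalReward]

/-- The weights of `mixLaw`. -/
def mixWeight (N : ℕ) (q m : ℝ) : Kind N → ℝ
  | Sum.inl _ => (1 - q) / (2 * N)
  | Sum.inr z => ![0, q * (1 + m) / 2, q * (1 - m) / 2] z

variable {N : ℕ}

theorem mixWeight_nonneg {q m : ℝ} (hq0 : 0 ≤ q) (hq1 : q ≤ 1) (hm : |m| ≤ 1) (κ : Kind N) :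
    0 ≤ mixWeight N q m κ := by
  obtain ⟨hm1, hm2⟩ := abs_le.1 hm
  rcases κ with o | z
  · exact div_nonneg (by linarith) (by positivity)
  · fin_cases z
    · exact le_rfl
    · exact div_nonneg (mul_nonneg hq0 (by linarith)) (by norm_num)
    · exact div_nonneg (mul_nonneg hq0 (by linarith)) (by norm_num)

theorem sum_mixWeight_mul [NeZero N] (q m : ℝ) (f : Kind N → ℝ) :
    ∑ κ, mixWeight N q m κ * f κ = (1 - q) / (2 * N) * ∑ o, f (Sum.inl o) +
      (q * (1 + m) / 2 * f (Sum.inr 1) + q * (1 - m) / 2 * f (Sum.inr 2)) := by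
  rw [Fintype.sum_sum_type, Fin.sum_univ_three, Finset.mul_sum]
  simp [mixWeight]

theorem sum_mixWeight [NeZero N] (q m : ℝ) : ∑ κ, mixWeight N q m κ = 1 := by
  have h := sum_mixWeight_mul (N := N) q m fun _ => 1
  have hN : (N : ℝ) ≠ 0 := NeZero.ne _
  simp only [mul_one] at h
  rw [h]
  simp only [Finset.sum_const, Finset.card_univ, Fintype.card_prod, Fintype.card_fin,
    Fintype.card_bool, nsmul_eq_mul]
  push_cast
  field_simp
  ring

/-- A uniform observation with probability `1 - q`, and otherwise one of the terminal states with
rewards `1` and `-1`, of mean `m`. -/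
def mixLaw (N : ℕ) [NeZero N] (q m : ℝ) (hq0 : 0 ≤ q) (hq1 : q ≤ 1) (hm : |m| ≤ 1) :
    PMF (Kind N) :=
  PMF.ofFintype (fun κ => ENNReal.ofReal (mixWeight N q m κ)) (by
    rw [← ENNReal.ofReal_sum_of_nonneg fun κ _ => mixWeight_nonneg hq0 hq1 hm κ, sum_mixWeight,
      ENNReal.ofReal_one])

theorem mixLaw_apply [NeZero N] {q m : ℝ} (hq0 : 0 ≤ q) (hq1 : q ≤ 1) (hm : |m| ≤ 1)
    (κ : Kind N) : mixLaw N q m hq0 hq1 hm κ = ENNReal.ofReal (mixWeight N q m κ) := rfl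

theorem expect_mixLaw [NeZero N] {q m : ℝ} (hq0 : 0 ≤ q) (hq1 : q ≤ 1) (hm : |m| ≤ 1)
    (f : Kind N → ℝ) :
    expect (mixLaw N q m hq0 hq1 hm) f = (1 - q) / (2 * N) * ∑ o, f (Sum.inl o) +
      (q * (1 + m) / 2 * f (Sum.inr 1) + q * (1 - m) / 2 * f (Sum.inr 2)) := by
  unfold expect
  rw [tsum_fintype, ← sum_mixWeight_mul]
  refine Finset.sum_congr rfl fun κ _ => ?_
  rw [mixLaw_apply, ENNReal.toReal_ofReal (mixWeight_nonneg hq0 hq1 hm κ)]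

theorem expect_mixLaw_of_const [NeZero N] {q m : ℝ} (hq0 : 0 ≤ q) (hq1 : q ≤ 1) (hm : |m| ≤ 1)
    (f : Kind N → ℝ) (c : ℝ) (hc : ∀ o, f (Sum.inl o) = c) :
    expect (mixLaw N q m hq0 hq1 hm) f = (1 - q) * c +
      (q * (1 + m) / 2 * f (Sum.inr 1) + q * (1 - m) / 2 * f (Sum.inr 2)) := by
  have hN : (N : ℝ) ≠ 0 := NeZero.ne _
  rw [expect_mixLaw]
  simp only [hc, Finset.sum_const, Finset.card_univ, Fintype.card_prod, Fintype.card_fin,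
    Fintype.card_bool, nsmul_eq_mul]
  push_cast
  field_simp

/-- The law on two actions that plays the first one with probability `p`. -/
def actionLaw (p : ℝ) (hp0 : 0 ≤ p) (hp1 : p ≤ 1) : PMF (Fin 2) :=
  PMF.ofFintype ![ENNReal.ofReal p, ENNReal.ofReal (1 - p)] (by
    rw [Fin.sum_univ_two]
    simp only [Matrix.cons_val_zero, Matrix.cons_val_one]
    rw [← ENNReal.ofReal_add hp0 (by linarith)]
    simp)

theorem actionLaw_zero {p : ℝ} (hp0 : 0 ≤ p) (hp1 : p ≤ 1) :
    actionLaw p hp0 hp1 0 = ENNReal.ofReal p := rfl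

theorem actionLaw_one {p : ℝ} (hp0 : 0 ≤ p) (hp1 : p ≤ 1) :
    actionLaw p hp0 hp1 1 = ENNReal.ofReal (1 - p) := rfl

theorem expect_map_of_finite {α β : Type} [Finite β] (p : PMF α) (g : α → β) (f : β → ℝ) :
    expect (p.map g) f = expect p (f ∘ g) := by
  cases nonempty_fintype β
  exact expect_map p g (B := ∑ b, |f b|) fun b =>
    Finset.single_le_sum (f := fun b => |f b|) (fun b _ => abs_nonneg _) (Finset.mem_univ b)

end Kernels

/-! ### The hard problems and their value functions -/

section Instance

variable {K N : ℕ}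

/-- The value of the evaluation policy after a given action. -/
def valueFn (s : Bool) (x : State K N) (a : Fin 2) : ℝ :=
  match x.2 with
  | Sum.inl _ => if a = 0 then sgn s * gap K x.1 else 0
  | Sum.inr z => terminalReward z

theorem abs_valueFn_le (s : Bool) (x : State K N) (a : Fin 2) : |valueFn s x a| ≤ 1 := by
  obtain ⟨h, o | z⟩ := x
  · simp only [valueFn]
    split_ifs
    · exact abs_sgn_mul_gap_le K s h
    · simp
  · exact abs_terminalReward_le z

variable [NeZero N]

/-- The place of the hidden bit that determines the label of a state. -/
def key (x : State K N) : Fin (K + 1) × Fin N :=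
  (x.1, match x.2 with
    | Sum.inl o => o.1
    -- An arbitrary default: the label of a terminal state ignores the bit.
    | Sum.inr _ => 0)

/-- The label of a state, given the hidden bit at `key x`. Labelled observations are the bad ones,
from which the chain can continue. -/
def label (x : State K N) (t : Bool) : Bool :=
  match x.2 with
  | Sum.inl o => xor o.2 t
  | Sum.inr _ => true

/-- The successor of a layer; the last layer is its own successor. -/
def nextLayer (h : Fin (K + 1)) : Fin (K + 1) := ⟨min (h + 1) K, by omega⟩

/-- The law of the next state inside its layer, given the label of the current state. -/
def kindLaw (s ℓ : Bool) (x : State K N) (a : Fin 2) : PMF (Kind N) :=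
  match x.2 with
  | Sum.inl _ =>
    if a = 0 then
      -- Good observations always exit, with the true sign; bad ones exit rarely, with the reversed
      -- sign.
      mixLaw N (if ℓ then slip K else 1) (sgn (xor s ℓ) * gap K x.1)
        (by split_ifs <;> linarith [slip_pos K]) (by split_ifs <;> linarith [slip_le K])
        (abs_sgn_mul_gap_le K _ x.1)
    else PMF.pure (Sum.inr 0)
  | Sum.inr _ => PMF.pure (Sum.inr 0)

/-- Rewards are deterministic, and given in terminal states and in the last layer only. -/
def rewardFn (s : Bool) (x : State K N) (a : Fin 2) : Reward :=
  -- Paying the value itself in the last layer closes the recursion. Only there, in an observation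
  -- under action `0`, does a reward depend on `s`.
  if x.2.isRight ∨ x.1 = Fin.last K then ⟨valueFn s x a, abs_le.1 (abs_valueFn_le s x a)⟩
  else ⟨0, by norm_num⟩

/-- The hard MDP with the sign `s` and the hidden bits `θ`. -/
def mdp (s : Bool) (θ : Fin (K + 1) × Fin N → Bool) :
    MDP (State K N) (Fin 2) (K + 1) Prod.fst where
  init := (mixLaw N 0 0 le_rfl zero_le_one (by simp)).map (Prod.mk 0)
  trans x a := (kindLaw s (label x (θ (key x))) x a).map (Prod.mk (nextLayer x.1))
  reward x a := PMF.pure (rewardFn s x a)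
  init_layer x hx := by
    obtain ⟨κ, -, rfl⟩ := (PMF.mem_support_map_iff _ _ _).1 hx
    rfl
  trans_layer x a hx x' hx' := by
    obtain ⟨κ, -, rfl⟩ := (PMF.mem_support_map_iff _ _ _).1 hx'
    simp only [nextLayer]
    omega

/-- The action law of the behavior policy in a state with a given label. -/
def behaviorLaw (K : ℕ) (ℓ : Bool) : PMF (Fin 2) :=
  actionLaw (if ℓ then 1 else slip K) (by split_ifs <;> linarith [slip_pos K])
    (by split_ifs <;> linarith [slip_le K])

/-- The behavior policy. -/
def behavior (θ : Fin (K + 1) × Fin N → Bool) : Policy (State K N) (Fin 2) :=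
  fun x => behaviorLaw K (label x (θ (key x)))

/-- Backward induction: `hk` says that `k` is the number of steps left at `x`, so that the inductive
hypothesis is available at the next layer. -/
theorem expect_rollout (s : Bool) (θ : Fin (K + 1) × Fin N → Bool) (k : ℕ) (x : State K N)
    (a : Fin 2) (hk : k + x.1 = K + 1) :
    expect ((mdp s θ).rollout (detPolicy fun _ => 0) k x a) MDP.totalReward = valueFn s x a := by
  induction k generalizing x a with
  | zero => have := x.1.2; omega
  | succ k ih =>
    rw [MDP.expect_rollout_succ (mdp s θ) (fun _ => 0) k x a (rewardFn s x a) rfl]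
    simp only [mdp]
    rw [expect_map_of_finite]
    by_cases hlast : x.1 = Fin.last K
    · have hk0 : k = 0 := by
        rw [hlast, Fin.val_last] at hk
        omega
      subst hk0
      have h0 : ((fun x' => expect ((mdp s θ).rollout (detPolicy fun _ => 0) 0 x' 0)
          MDP.totalReward) ∘ Prod.mk (nextLayer x.1)) = fun _ : Kind N => (0 : ℝ) := by
        funext κ
        exact MDP.expect_rollout_zero _ _ _ _
      have h1 : ∀ p : PMF (Kind N), expect p (fun _ => 0) = 0 := fun p => by simp [expect]
      simp only [mdp] at h0
      rw [h0, h1]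
      simp [rewardFn, hlast]
    · have hlt : (x.1 : ℕ) < K := by
        have h1 := x.1.2
        have h2 : (x.1 : ℕ) ≠ K := fun h => hlast (Fin.ext h)
        omega
      have hnext : ((nextLayer x.1 : Fin (K + 1)) : ℕ) = x.1 + 1 := by
        simp only [nextLayer]
        omega
      have hf : ((fun x' => expect ((mdp s θ).rollout (detPolicy fun _ => 0) k x' 0)
          MDP.totalReward) ∘ Prod.mk (nextLayer x.1)) =
          fun κ : Kind N => valueFn s (nextLayer x.1, κ) 0 := by
        funext κ
        refine ih (nextLayer x.1, κ) 0 ?_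
        simp only [hnext]
        omega
      simp only [mdp] at hf
      rw [hf]
      -- From here on the label is arbitrary: the value must come out the same for good and bad
      -- observations.
      generalize label x (θ (key x)) = ℓ
      obtain ⟨h, o | z⟩ := x
      · simp only [rewardFn, hlast, Sum.isRight_inl, Bool.false_eq_true, or_self, if_false,
          kindLaw, zero_add]
        by_cases ha : a = 0
        · subst ha
          rw [if_pos rfl, expect_mixLaw_of_const _ _ _ _ (sgn s * gap K (h + 1)) fun o => by
            simp [valueFn, hnext]]
          simp only [valueFn, if_true, terminalReward]
          have hg := gap_succ K h
          cases s <;> cases ℓ <;> simp [sgn] <;> linarith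
        · rw [if_neg ha, expect_pure]
          simp [valueFn, terminalReward, ha]
      · simp [rewardFn, kindLaw, expect_pure, valueFn, terminalReward]

theorem actionValue_eq (s : Bool) (θ : Fin (K + 1) × Fin N → Bool) :
    (mdp s θ).actionValue (detPolicy fun _ => 0) = valueFn s := by
  funext x a
  exact expect_rollout s θ _ x a (Nat.sub_add_cancel x.1.2.le)

theorem value_eq (s : Bool) (θ : Fin (K + 1) × Fin N → Bool) :
    (mdp s θ).value (detPolicy fun _ => 0) = sgn s * (1 / 3) := by
  rw [MDP.value_detPolicy, actionValue_eq]
  simp only [mdp]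
  rw [expect_map_of_finite, expect_mixLaw_of_const _ _ _ _ (sgn s * gap K 0) fun o => by
    simp [valueFn]]
  simp [gap_zero]

theorem valueFn_ne : (valueFn true : State K N → Fin 2 → ℝ) ≠ valueFn false := fun h => by
  have h1 := congrFun (congrFun h (0, Sum.inl (0, true))) 0
  simp only [valueFn, sgn, Fin.val_zero, gap_zero] at h1
  norm_num at h1

/-- The hard evaluation problem with the sign `s` and the hidden bits `θ`. -/
def problem (s : Bool) (θ : Fin (K + 1) × Fin N → Bool) :
    OPEProblem (State K N) (Fin 2) (K + 1) Prod.fst where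
  mdp := mdp s θ
  evalPolicy := fun _ => 0
  behaviorPolicy := behavior θ
  funClass := {valueFn true, valueFn false}
  funClass_bounded f hf x a := by
    rcases hf with rfl | rfl
    · exact abs_le.1 (abs_valueFn_le true x a)
    · exact abs_le.1 (abs_valueFn_le false x a)

theorem realizable_problem (s : Bool) (θ : Fin (K + 1) × Fin N → Bool) :
    (problem s θ).Realizable := by
  simp only [OPEProblem.Realizable, problem, actionValue_eq]
  cases s <;> simp

end Instance

/-! ### Concentrability and decay of the observation probabilities -/

section Exploration

variable {K N : ℕ}

/-- A lower bound for the ratio of the occupancies of the behavior and the evaluation policy. -/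
def coverage (x : State K N) : ℝ≥0∞ :=
  match x.2 with
  | Sum.inl _ => 1
  | Sum.inr _ => ENNReal.ofReal (slip K)

theorem ofReal_slip_le_one (K : ℕ) : ENNReal.ofReal (slip K) ≤ 1 :=
  ENNReal.ofReal_le_one.2 (slip_le_one K)

theorem coverage_le_one (x : State K N) : coverage x ≤ 1 := by
  obtain ⟨l, o | z⟩ := x
  · exact le_rfl
  · exact ofReal_slip_le_one K

theorem tsum_state_eq (h : Fin (K + 1)) (F : State K N → ℝ≥0∞)
    (hF : ∀ x, x.1 ≠ h ∨ x.2.isRight → F x = 0) :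
    ∑' x, F x = ∑ j, ∑ b, F (h, Sum.inl (j, b)) := by
  rw [tsum_fintype, Fintype.sum_prod_type, Finset.sum_eq_single h, Fintype.sum_sum_type,
    Fintype.sum_prod_type]
  · simp [hF]
  · intro l _ hl
    exact Finset.sum_eq_zero fun κ _ => hF _ (Or.inl hl)
  · simp

theorem sum_xor (t : Bool) (f : Bool → ℝ≥0∞) : ∑ b, f (xor b t) = f true + f false := by
  cases t <;> simp [add_comm]

variable [NeZero N]

section Coverage

theorem behaviorLaw_true_zero (K : ℕ) : behaviorLaw K true 0 = 1 := by
  simp [behaviorLaw, actionLaw_zero]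

theorem behaviorLaw_false_zero (K : ℕ) : behaviorLaw K false 0 = ENNReal.ofReal (slip K) := by
  simp [behaviorLaw, actionLaw_zero]

theorem trans_apply (s : Bool) (θ : Fin (K + 1) × Fin N → Bool) (x : State K N) (a : Fin 2)
    (y : State K N) :
    (mdp s θ).trans x a y =
      if y.1 = nextLayer x.1 then kindLaw s (label x (θ (key x))) x a y.2 else 0 :=
  map_prodMk_apply _ _ _

theorem kindLaw_inl_eq_zero {s ℓ : Bool} {x : State K N} {a : Fin 2} (o : Fin N × Bool)
    (h : x.2.isRight ∨ a ≠ 0 ∨ ℓ = false) : kindLaw s ℓ x a (Sum.inl o) = 0 := by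
  obtain ⟨l, o' | z⟩ := x
  · by_cases ha : a = 0
    · have hℓ : ℓ = false := by simpa [ha] using h
      simp [kindLaw, ha, hℓ, mixLaw_apply, mixWeight]
    · simp [kindLaw, ha, PMF.pure_apply]
  · simp [kindLaw, PMF.pure_apply]

theorem kindLaw_inl_le (s ℓ : Bool) (x : State K N) (a : Fin 2) (o : Fin N × Bool) :
    kindLaw s ℓ x a (Sum.inl o) ≤ ENNReal.ofReal (1 / (2 * N)) := by
  by_cases h : x.2.isRight ∨ a ≠ 0 ∨ ℓ = false
  · rw [kindLaw_inl_eq_zero o h]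
    exact zero_le
  · obtain ⟨l, o' | z⟩ := x
    · simp only [Sum.isRight_inl, Bool.false_eq_true, false_or, not_or, not_not,
        Bool.not_eq_false] at h
      simp only [kindLaw, h.1, h.2, if_true, mixLaw_apply, mixWeight]
      refine ENNReal.ofReal_le_ofReal (div_le_div_of_nonneg_right ?_ (by positivity))
      linarith [slip_pos K]
    · simp at h

theorem slip_le_coverage_mul (θ : Fin (K + 1) × Fin N → Bool) (x : State K N) :
    ENNReal.ofReal (slip K) ≤ coverage x * behavior θ x 0 := by
  obtain ⟨l, o | z⟩ := x
  · simp only [coverage, one_mul, behavior]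
    cases label ((l, Sum.inl o) : State K N) (θ (key (l, Sum.inl o)))
    · rw [behaviorLaw_false_zero]
    · rw [behaviorLaw_true_zero]
      exact ofReal_slip_le_one K
  · simp [coverage, behavior, label, behaviorLaw_true_zero]

/-- Observations are entered only from bad observations, where the behavior policy plays `0` surely,
so nothing is lost. A factor `slip` is lost only on entering a terminal state, and no further loss
follows. -/
theorem coverage_le_of_trans_ne_zero (s : Bool) (θ : Fin (K + 1) × Fin N → Bool)
    (x y : State K N) (h : (mdp s θ).trans x 0 y ≠ 0) :
    coverage y ≤ coverage x * behavior θ x 0 := by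
  obtain ⟨l', o' | z'⟩ := y
  · rw [trans_apply] at h
    have h1 := (ite_ne_right_iff.1 h).2
    obtain ⟨l, o | z⟩ := x
    · have hℓ : label ((l, Sum.inl o) : State K N) (θ (key (l, Sum.inl o))) = true := by
        by_contra hℓ
        exact h1 (kindLaw_inl_eq_zero o' (Or.inr (Or.inr (by simpa using hℓ))))
      simp [coverage, behavior, hℓ, behaviorLaw_true_zero]
    · exact absurd (kindLaw_inl_eq_zero o' (Or.inl rfl)) h1
  · exact slip_le_coverage_mul θ x

theorem coverage_mul_stateLaw_le (s : Bool) (θ : Fin (K + 1) × Fin N → Bool) (h : ℕ)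
    (x : State K N) :
    coverage x * (mdp s θ).stateLaw (detPolicy fun _ => 0) h x ≤
      (mdp s θ).stateLaw (behavior θ) h x := by
  induction h generalizing x with
  | zero => exact mul_le_of_le_one_left zero_le (coverage_le_one x)
  | succ h ih =>
    rw [MDP.stateLaw_succ_apply, MDP.stateLaw_succ_apply, ← ENNReal.tsum_mul_left]
    refine ENNReal.tsum_le_tsum fun y => ?_
    have h1 : ∑' a, detPolicy (fun _ : State K N => (0 : Fin 2)) y a * (mdp s θ).trans y a x =
        (mdp s θ).trans y 0 x := by
      rw [tsum_eq_single 0]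
      · simp [detPolicy]
      · intro a ha
        simp [detPolicy, PMF.pure_apply, ha]
    rw [h1]
    have h2 : behavior θ y 0 * (mdp s θ).trans y 0 x ≤
        ∑' a, behavior θ y a * (mdp s θ).trans y a x :=
      ENNReal.le_tsum (f := fun a => behavior θ y a * (mdp s θ).trans y a x) 0
    refine le_trans ?_ (mul_le_mul_right h2 _)
    by_cases hT : (mdp s θ).trans y 0 x = 0
    · simp [hT]
    · calc coverage x * ((mdp s θ).stateLaw (detPolicy fun _ => 0) h y * (mdp s θ).trans y 0 x)
          ≤ coverage y * behavior θ y 0 *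
              ((mdp s θ).stateLaw (detPolicy fun _ => 0) h y * (mdp s θ).trans y 0 x) :=
            mul_le_mul_left (coverage_le_of_trans_ne_zero s θ y x hT) _
        _ = coverage y * (mdp s θ).stateLaw (detPolicy fun _ => 0) h y *
              (behavior θ y 0 * (mdp s θ).trans y 0 x) := by ring
        _ ≤ _ := mul_le_mul_left (ih y) _

theorem concentrability_problem_le (s : Bool) (θ : Fin (K + 1) × Fin N → Bool) :
    (problem s θ).concentrability ≤ ENNReal.ofReal (2 * ((K : ℝ) + 1) + 1) := by
  have hslip : ENNReal.ofReal (2 * ((K : ℝ) + 1) + 1) * ENNReal.ofReal (slip K) = 1 := by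
    rw [← ENNReal.ofReal_mul (by positivity), slip, mul_one_div_cancel (by positivity),
      ENNReal.ofReal_one]
  refine iSup_le fun h => iSup_le fun x => iSup_le fun a => ENNReal.div_le_of_le_mul ?_
  simp only [MDP.occupancy, MDP.stateOccupancy_eq, problem]
  by_cases ha : a = 0
  · subst ha
    generalize ENNReal.ofReal (2 * ((K : ℝ) + 1) + 1) = C at hslip ⊢
    simp only [detPolicy, PMF.pure_apply, if_true, mul_one]
    calc (mdp s θ).stateLaw (detPolicy fun _ => 0) h x
        = C * (ENNReal.ofReal (slip K) * (mdp s θ).stateLaw (detPolicy fun _ => 0) h x) := by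
          rw [← mul_assoc, hslip, one_mul]
      _ ≤ C * (coverage x * behavior θ x 0 *
            (mdp s θ).stateLaw (detPolicy fun _ => 0) h x) := by
          gcongr
          exact slip_le_coverage_mul θ x
      _ = C * (coverage x * (mdp s θ).stateLaw (detPolicy fun _ => 0) h x *
            behavior θ x 0) := by ring
      _ ≤ C * ((mdp s θ).stateLaw (behavior θ) h x * behavior θ x 0) := by
          gcongr
          exact coverage_mul_stateLaw_le s θ h x
  · simp [detPolicy, PMF.pure_apply, ha]

end Coverage

section Occupancy

theorem stateLaw_eq_zero_of_layer_ne (s : Bool) (θ : Fin (K + 1) × Fin N → Bool)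
    (h : Fin (K + 1)) (x : State K N) (hx : x.1 ≠ h) :
    (mdp s θ).stateLaw (behavior θ) h x = 0 := by
  by_contra h0
  exact hx (Fin.ext (MDP.layer_of_stateLaw_ne_zero (mdp s θ) (behavior θ) h h.2 x h0))

/-- Exactly one member of each pair is bad and only bad observations continue, so each layer halves
the mass, which is then spread uniformly. -/
theorem stateLaw_observation_le (s : Bool) (θ : Fin (K + 1) × Fin N → Bool) (h : ℕ)
    (hh : h ≤ K) (l : Fin (K + 1)) (o : Fin N × Bool) :
    (mdp s θ).stateLaw (behavior θ) h (l, Sum.inl o) ≤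
      ENNReal.ofReal ((1 / 2) ^ h / (2 * N)) := by
  induction h generalizing l o with
  | zero =>
    have h1 : (mdp s θ).stateLaw (behavior θ) 0 (l, Sum.inl o) =
        if l = 0 then mixLaw N 0 0 le_rfl zero_le_one (by simp) (Sum.inl o) else 0 :=
      map_prodMk_apply _ _ _
    rw [h1]
    split_ifs
    · simp [mixLaw_apply, mixWeight]
    · exact zero_le
  | succ h ih =>
    have hN : (N : ℝ) ≠ 0 := NeZero.ne _
    have hlt : h < K + 1 := by omega
    rw [MDP.stateLaw_succ_apply, tsum_state_eq ⟨h, hlt⟩]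
    · calc ∑ j, ∑ b, (mdp s θ).stateLaw (behavior θ) h (⟨h, hlt⟩, Sum.inl (j, b)) *
            ∑' a, behavior θ (⟨h, hlt⟩, Sum.inl (j, b)) a *
              (mdp s θ).trans (⟨h, hlt⟩, Sum.inl (j, b)) a (l, Sum.inl o)
          ≤ ∑ j : Fin N, ∑ b : Bool, ENNReal.ofReal ((1 / 2) ^ h / (2 * N)) *
              (if xor b (θ (⟨h, hlt⟩, j)) then ENNReal.ofReal (1 / (2 * N)) else 0) := by
            refine Finset.sum_le_sum fun j _ => Finset.sum_le_sum fun b _ =>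
              mul_le_mul' (ih (by omega) _ _) ?_
            split_ifs with hℓ
            · calc _ ≤ ∑' a, behavior θ (⟨h, hlt⟩, Sum.inl (j, b)) a *
                    ENNReal.ofReal (1 / (2 * N)) := by
                    refine ENNReal.tsum_le_tsum fun a => mul_le_mul_right ?_ _
                    rw [trans_apply]
                    split_ifs
                    · exact kindLaw_inl_le _ _ _ _ _
                    · exact zero_le
                _ = _ := by rw [ENNReal.tsum_mul_right, PMF.tsum_coe, one_mul]
            · refine le_of_eq (ENNReal.tsum_eq_zero.2 fun a => ?_)
              rw [trans_apply, kindLaw_inl_eq_zero o (Or.inr (Or.inr (by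
                simpa [label, key] using hℓ)))]
              simp
        _ = ENNReal.ofReal ((1 / 2) ^ (h + 1) / (2 * N)) := by
            simp_rw [← Finset.mul_sum, sum_xor _ fun b => if b = true then
              ENNReal.ofReal (1 / (2 * N)) else 0]
            simp only [if_true, Bool.false_eq_true, if_false, add_zero, Finset.sum_const,
              Finset.card_univ, Fintype.card_fin, nsmul_eq_mul]
            rw [← ENNReal.ofReal_natCast, ← ENNReal.ofReal_mul (by positivity),
              ← ENNReal.ofReal_mul (by positivity)]
            congr 1
            rw [pow_succ]
            field_simp
    · rintro x (hx | hx)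
      · rw [stateLaw_eq_zero_of_layer_ne s θ ⟨h, hlt⟩ x hx, zero_mul]
      · refine mul_eq_zero_of_right _ (ENNReal.tsum_eq_zero.2 fun a => ?_)
        rw [trans_apply, kindLaw_inl_eq_zero o (Or.inl hx)]
        simp

end Occupancy

end Exploration

/-! ### Most small data sets are uninformative -/

section DataSets

variable {K N : ℕ}

/-- The pair to which an observation belongs. -/
def pairIndex (x : State K N) : Option (Fin N) :=
  match x.2 with
  | Sum.inl o => some o.1
  | Sum.inr _ => none

/-- The trajectory visits the layers in order. -/
def Layered (τ : Trajectory (State K N) (Fin 2) (K + 1)) : Prop := ∀ h, (τ h).1.1 = h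

/-- The first action is played in an observation of the last layer. -/
def Revealing (τ : Trajectory (State K N) (Fin 2) (K + 1)) : Prop :=
  (τ (Fin.last K)).1.2.isLeft ∧ (τ (Fin.last K)).2.1 = 0

/-- Data sets without revealing trajectories and without collisions of observations. -/
structure Uninformative {n : ℕ} (D : Fin n → Trajectory (State K N) (Fin 2) (K + 1)) : Prop where
  layered : ∀ i, Layered (D i)
  not_revealing : ∀ i, ¬ Revealing (D i)
  no_collision : ∀ i i' h j, i ≠ i' → pairIndex (D i h).1 = some j →
    pairIndex (D i' h).1 ≠ some j

open Classical in
-- A pointwise union bound. Collisions are split by the shared pair `j`, so that each term is a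
-- product of functions of two independent trajectories.
theorem one_le_indicator_add {n : ℕ} (D : Fin n → Trajectory (State K N) (Fin 2) (K + 1)) :
    (1 : ℝ≥0∞) ≤ (if Uninformative D then 1 else 0) +
      (∑ i, ∑ h, (if (D i h).1.1 ≠ h then 1 else 0) + (∑ i, (if Revealing (D i) then 1 else 0) +
        ∑ i, ∑ i', ∑ h, ∑ j, if i ≠ i' then (if pairIndex (D i h).1 = some j then 1 else 0) *
          (if pairIndex (D i' h).1 = some j then 1 else 0) else 0)) := by
  by_cases hD : Uninformative D
  · rw [if_pos hD]
    exact le_self_add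
  · by_cases h1 : ∀ i, Layered (D i)
    · by_cases h2 : ∀ i, ¬ Revealing (D i)
      · have h3 : ∃ i i' h j, i ≠ i' ∧ pairIndex (D i h).1 = some j ∧
            pairIndex (D i' h).1 = some j := by
          by_contra h3
          exact hD ⟨h1, h2, fun i i' h j hne hj hj' => h3 ⟨i, i', h, j, hne, hj, hj'⟩⟩
        obtain ⟨i, i', h, j, hne, hj, hj'⟩ := h3
        refine le_trans ?_ (le_add_self.trans (le_add_self.trans le_add_self))
        refine le_trans ?_ (Finset.single_le_sum (fun _ _ => zero_le) (Finset.mem_univ i))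
        refine le_trans ?_ (Finset.single_le_sum (fun _ _ => zero_le) (Finset.mem_univ i'))
        refine le_trans ?_ (Finset.single_le_sum (fun _ _ => zero_le) (Finset.mem_univ h))
        refine le_trans ?_ (Finset.single_le_sum (fun _ _ => zero_le) (Finset.mem_univ j))
        simp [hne, hj, hj']
      · push Not at h2
        obtain ⟨i, hi⟩ := h2
        refine le_trans ?_ (le_self_add.trans (le_add_self.trans le_add_self))
        refine le_trans ?_ (Finset.single_le_sum (fun _ _ => zero_le) (Finset.mem_univ i))
        simp [hi]
    · unfold Layered at h1
      push Not at h1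
      obtain ⟨i, h, hi⟩ := h1
      refine le_trans ?_ (le_self_add.trans le_add_self)
      refine le_trans ?_ (Finset.single_le_sum (fun _ _ => zero_le) (Finset.mem_univ i))
      refine le_trans ?_ (Finset.single_le_sum (fun _ _ => zero_le) (Finset.mem_univ h))
      simp [hi]

variable [NeZero N]

/-- The law of one trajectory of the behavior policy. -/
def dataLaw (s : Bool) (θ : Fin (K + 1) × Fin N → Bool) :
    PMF (Trajectory (State K N) (Fin 2) (K + 1)) :=
  (mdp s θ).trajectoryLaw (behavior θ)

open Classical in
theorem tsum_dataLaw_not_layered (s : Bool) (θ : Fin (K + 1) × Fin N → Bool) (h : Fin (K + 1)) :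
    ∑' τ, dataLaw s θ τ * (if (τ h).1.1 ≠ h then 1 else 0) = 0 := by
  unfold dataLaw
  rw [(mdp s θ).tsum_trajectoryLaw_mul_state (behavior θ) h fun x => if x.1 ≠ h then 1 else 0]
  refine ENNReal.tsum_eq_zero.2 fun x => ?_
  by_cases hx : x.1 = h
  · simp [hx]
  · rw [stateLaw_eq_zero_of_layer_ne s θ h x hx, zero_mul]

open Classical in
theorem tsum_dataLaw_pairIndex_le (s : Bool) (θ : Fin (K + 1) × Fin N → Bool) (h : Fin (K + 1))
    (j : Fin N) :
    ∑' τ, dataLaw s θ τ * (if pairIndex (τ h).1 = some j then 1 else 0) ≤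
      ENNReal.ofReal (1 / N) := by
  have hN : (0 : ℝ) < N := Nat.cast_pos.2 (NeZero.pos N)
  unfold dataLaw
  rw [(mdp s θ).tsum_trajectoryLaw_mul_state (behavior θ) h fun x =>
    if pairIndex x = some j then 1 else 0, tsum_state_eq h]
  · rw [Finset.sum_eq_single j]
    · calc ∑ b, (mdp s θ).stateLaw (behavior θ) h (h, Sum.inl (j, b)) *
            (if pairIndex ((h, Sum.inl (j, b)) : State K N) = some j then 1 else 0)
          ≤ ∑ _b : Bool, ENNReal.ofReal (1 / (2 * N)) := by
            refine Finset.sum_le_sum fun b _ => ?_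
            simp only [pairIndex, if_true, mul_one]
            refine (stateLaw_observation_le s θ h (by omega) h (j, b)).trans
              (ENNReal.ofReal_le_ofReal (div_le_div_of_nonneg_right ?_ (by positivity)))
            exact pow_le_one₀ (by norm_num) (by norm_num)
        _ = ENNReal.ofReal (1 / N) := by
            rw [Fintype.sum_bool, ← ENNReal.ofReal_add (by positivity) (by positivity)]
            congr 1
            field_simp
            norm_num
    · intro j' _ hj'
      simp [pairIndex, hj']
    · simp
  · rintro ⟨l, κ⟩ (hx | hx)
    · rw [stateLaw_eq_zero_of_layer_ne s θ h _ hx, zero_mul]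
    · rcases κ with o | z
      · simp at hx
      · simp [pairIndex]

open Classical in
-- Survival to the last layer costs 2^{-K}. There the two members of a pair play action `0` with
-- average probability (1 + p)/2 ≤ 2/3, as p ≤ 1/3.
theorem tsum_dataLaw_revealing_le (s : Bool) (θ : Fin (K + 1) × Fin N → Bool) :
    ∑' τ, dataLaw s θ τ * (if Revealing τ then 1 else 0) ≤
      ENNReal.ofReal ((1 / 2) ^ K * (2 / 3)) := by
  have hN : (0 : ℝ) < N := Nat.cast_pos.2 (NeZero.pos N)
  have hR : ∀ τ : Trajectory (State K N) (Fin 2) (K + 1),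
      (if Revealing τ then (1 : ℝ≥0∞) else 0) =
      if (τ (Fin.last K)).1.2.isLeft ∧ (τ (Fin.last K)).2.1 = 0 then 1 else 0 := fun τ =>
    if_congr Iff.rfl rfl rfl
  simp_rw [hR]
  refine ((mdp s θ).tsum_trajectoryLaw_mul_step (behavior θ) (Fin.last K) fun z =>
    if z.1.2.isLeft ∧ z.2 = 0 then 1 else 0).trans_le ?_
  rw [tsum_state_eq (Fin.last K)]
  · calc ∑ j, ∑ b, (mdp s θ).stateLaw (behavior θ) (Fin.last K) (Fin.last K, Sum.inl (j, b)) *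
          ∑' a, behavior θ (Fin.last K, Sum.inl (j, b)) a *
            (if (Sum.inl (j, b) : Kind N).isLeft ∧ a = 0 then 1 else 0)
        ≤ ∑ j : Fin N, ∑ b : Bool, ENNReal.ofReal ((1 / 2) ^ K / (2 * N)) *
            behaviorLaw K (xor b (θ (Fin.last K, j))) 0 := by
          refine Finset.sum_le_sum fun j _ => Finset.sum_le_sum fun b _ => mul_le_mul' ?_ ?_
          · exact stateLaw_observation_le s θ K le_rfl _ _
          · rw [tsum_fintype, Fin.sum_univ_two]
            simp [behavior, label, key]
      _ = ENNReal.ofReal (N * ((1 / 2) ^ K / (2 * N) * (1 + slip K))) := by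
          simp_rw [← Finset.mul_sum, sum_xor _ fun b => behaviorLaw K b 0]
          rw [Finset.sum_const, Finset.card_univ, Fintype.card_fin, nsmul_eq_mul,
            behaviorLaw_true_zero, behaviorLaw_false_zero, ← ENNReal.ofReal_one,
            ← ENNReal.ofReal_add zero_le_one (slip_pos K).le, ← ENNReal.ofReal_natCast,
            ← ENNReal.ofReal_mul (by positivity), ← ENNReal.ofReal_mul (by positivity)]
          congr 1
          ring
      _ ≤ ENNReal.ofReal ((1 / 2) ^ K * (2 / 3)) := by
          refine ENNReal.ofReal_le_ofReal ?_
          have h1 : (N : ℝ) * ((1 / 2) ^ K / (2 * N) * (1 + slip K)) =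
              (1 / 2) ^ K * ((1 + slip K) / 2) := by field_simp
          rw [h1]
          exact mul_le_mul_of_nonneg_left (by linarith [slip_le K]) (by positivity)
  · rintro ⟨l, κ⟩ (hx | hx)
    · rw [stateLaw_eq_zero_of_layer_ne s θ (Fin.last K) _ hx, zero_mul]
    · rcases κ with o | z
      · simp at hx
      · simp

open Classical in
-- By independence the collision probability is ∑ p_j² ≤ max p_j · ∑ p_j, with p_j ≤ 1/N and ∑ p_j ≤
-- 1.
theorem tsum_collision_le (s : Bool) (θ : Fin (K + 1) × Fin N → Bool) {n : ℕ} (i i' : Fin n)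
    (h : Fin (K + 1)) :
    ∑' D : Fin n → Trajectory (State K N) (Fin 2) (K + 1), (∏ k, dataLaw s θ (D k)) *
      (∑ j, if i ≠ i' then (if pairIndex (D i h).1 = some j then 1 else 0) *
          (if pairIndex (D i' h).1 = some j then 1 else 0) else 0) ≤
      ENNReal.ofReal (1 / N) := by
  by_cases hne : i = i'
  · simp [hne]
  · simp only [ne_eq, hne, not_false_eq_true, if_true, Finset.mul_sum]
    rw [Summable.tsum_finsetSum fun _ _ => ENNReal.summable]
    calc ∑ j, ∑' D : Fin n → Trajectory (State K N) (Fin 2) (K + 1), (∏ k, dataLaw s θ (D k)) *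
          ((if pairIndex (D i h).1 = some j then 1 else 0) *
            (if pairIndex (D i' h).1 = some j then 1 else 0))
        = ∑ j, (∑' τ, dataLaw s θ τ * (if pairIndex (τ h).1 = some j then 1 else 0)) *
            ∑' τ, dataLaw s θ τ * (if pairIndex (τ h).1 = some j then 1 else 0) :=
          Finset.sum_congr rfl fun j _ => tsum_prod_pmf_mul_mul n (dataLaw s θ) hne
            (fun τ => if pairIndex (τ h).1 = some j then 1 else 0)
            (fun τ => if pairIndex (τ h).1 = some j then 1 else 0)
      _ ≤ ∑ j, (∑' τ, dataLaw s θ τ * (if pairIndex (τ h).1 = some j then 1 else 0)) *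
            ENNReal.ofReal (1 / N) := by
          gcongr with j
          exact tsum_dataLaw_pairIndex_le s θ h j
      _ = (∑' τ, dataLaw s θ τ * ∑ j, if pairIndex (τ h).1 = some j then 1 else 0) *
            ENNReal.ofReal (1 / N) := by
          rw [← Finset.sum_mul, ← Summable.tsum_finsetSum fun _ _ => ENNReal.summable]
          simp_rw [Finset.mul_sum]
      _ ≤ 1 * ENNReal.ofReal (1 / N) := by
          gcongr
          rw [← (dataLaw s θ).tsum_coe]
          refine ENNReal.tsum_le_tsum fun τ => mul_le_of_le_one_right zero_le ?_
          cases pairIndex (τ h).1 <;> simp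
      _ = _ := one_mul _

open Classical in
/-- Uninformative data sets have probability at least `1 / 4`. -/
theorem quarter_le_tsum_uninformative (s : Bool) (θ : Fin (K + 1) × Fin N → Bool) {n : ℕ}
    (hn : n ≤ 2 ^ K) (hN : 12 * (n * n * (K + 1)) ≤ N) :
    ENNReal.ofReal (1 / 4) ≤ ∑' D : Fin n → Trajectory (State K N) (Fin 2) (K + 1),
      (∏ k, dataLaw s θ (D k)) * if Uninformative D then 1 else 0 := by
  have hN0 : (0 : ℝ) < N := Nat.cast_pos.2 (NeZero.pos N)
  have h1 := ENNReal.tsum_le_tsum fun D : Fin n → Trajectory (State K N) (Fin 2) (K + 1) =>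
    mul_le_mul_right (one_le_indicator_add D) (∏ k, dataLaw s θ (D k))
  simp only [mul_one, tsum_prod_pmf, mul_add, ENNReal.tsum_add] at h1
  have hlay : ∑' D : Fin n → Trajectory (State K N) (Fin 2) (K + 1), (∏ k, dataLaw s θ (D k)) *
      ∑ i, ∑ h, (if (D i h).1.1 ≠ h then 1 else 0) = 0 := by
    simp_rw [Finset.mul_sum]
    rw [Summable.tsum_finsetSum fun _ _ => ENNReal.summable]
    refine Finset.sum_eq_zero fun i _ => ?_
    rw [Summable.tsum_finsetSum fun _ _ => ENNReal.summable]
    refine Finset.sum_eq_zero fun h _ => ?_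
    exact (tsum_prod_pmf_mul n (dataLaw s θ) i fun τ => if (τ h).1.1 ≠ h then 1 else 0).trans
      (tsum_dataLaw_not_layered s θ h)
  have hrev : ∑' D : Fin n → Trajectory (State K N) (Fin 2) (K + 1), (∏ k, dataLaw s θ (D k)) *
      ∑ i, (if Revealing (D i) then 1 else 0) ≤ ENNReal.ofReal (2 / 3) := by
    simp_rw [Finset.mul_sum]
    rw [Summable.tsum_finsetSum fun _ _ => ENNReal.summable]
    calc _ ≤ ∑ _i : Fin n, ENNReal.ofReal ((1 / 2) ^ K * (2 / 3)) :=
          Finset.sum_le_sum fun i _ =>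
            (tsum_prod_pmf_mul n (dataLaw s θ) i fun τ => if Revealing τ then 1 else 0).trans_le
              (tsum_dataLaw_revealing_le s θ)
      _ = ENNReal.ofReal (n * ((1 / 2) ^ K * (2 / 3))) := by
          rw [Finset.sum_const, Finset.card_univ, Fintype.card_fin, nsmul_eq_mul,
            ← ENNReal.ofReal_natCast, ← ENNReal.ofReal_mul (by positivity)]
      _ ≤ _ := by
          refine ENNReal.ofReal_le_ofReal ?_
          have h2 : (n : ℝ) ≤ 2 ^ K := by exact_mod_cast hn
          have h3 : (n : ℝ) * (1 / 2) ^ K ≤ 1 := by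
            rw [one_div, inv_pow, ← div_eq_mul_inv]
            exact (div_le_one (by positivity)).2 h2
          nlinarith
  have hcol : ∑' D : Fin n → Trajectory (State K N) (Fin 2) (K + 1), (∏ k, dataLaw s θ (D k)) *
      (∑ i, ∑ i', ∑ h, ∑ j, if i ≠ i' then (if pairIndex (D i h).1 = some j then 1 else 0) *
          (if pairIndex (D i' h).1 = some j then 1 else 0) else 0) ≤
      ENNReal.ofReal (1 / 12) := by
    calc _ = ∑ i, ∑ i', ∑ h, ∑' D : Fin n → Trajectory (State K N) (Fin 2) (K + 1),
          (∏ k, dataLaw s θ (D k)) *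
          (∑ j, if i ≠ i' then (if pairIndex (D i h).1 = some j then 1 else 0) *
            (if pairIndex (D i' h).1 = some j then 1 else 0) else 0) := by
          simp only [fun (c : ℝ≥0∞) (f : Fin n → ℝ≥0∞) => Finset.mul_sum Finset.univ f c,
            fun (c : ℝ≥0∞) (f : Fin (K + 1) → ℝ≥0∞) => Finset.mul_sum Finset.univ f c]
          rw [Summable.tsum_finsetSum fun _ _ => ENNReal.summable]
          refine Finset.sum_congr rfl fun i _ => ?_
          rw [Summable.tsum_finsetSum fun _ _ => ENNReal.summable]
          refine Finset.sum_congr rfl fun i' _ => ?_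
          rw [Summable.tsum_finsetSum fun _ _ => ENNReal.summable]
      _ ≤ ∑ _i : Fin n, ∑ _i' : Fin n, ∑ _h : Fin (K + 1), ENNReal.ofReal (1 / N) :=
          Finset.sum_le_sum fun i _ => Finset.sum_le_sum fun i' _ => Finset.sum_le_sum fun h _ =>
            tsum_collision_le s θ i i' h
      _ = ENNReal.ofReal (n * (n * ((K + 1 : ℕ) * (1 / N)))) := by
          simp only [Finset.sum_const, Finset.card_univ, Fintype.card_fin, nsmul_eq_mul]
          rw [ENNReal.ofReal_mul (by positivity), ENNReal.ofReal_mul (by positivity),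
            ENNReal.ofReal_mul (by positivity), ENNReal.ofReal_natCast, ENNReal.ofReal_natCast]
      _ ≤ _ := by
          refine ENNReal.ofReal_le_ofReal ?_
          have h2 : (12 : ℝ) * (n * n * ((K + 1 : ℕ) : ℝ)) ≤ N := by exact_mod_cast hN
          have h3 : (n : ℝ) * (n * ((K + 1 : ℕ) * (1 / N))) = n * n * ((K + 1 : ℕ) : ℝ) / N := by
            ring
          rw [h3, div_le_div_iff₀ hN0 (by norm_num)]
          linarith
  rw [hlay, zero_add] at h1
  -- The budget is 1 = 1/4 + 2/3 + 1/12: good data, revealing trajectories, collisions.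
  have h4 : (1 : ℝ≥0∞) = ENNReal.ofReal (1 / 4) + ENNReal.ofReal (3 / 4) := by
    rw [← ENNReal.ofReal_add (by norm_num) (by norm_num)]
    norm_num
  have h5 : ENNReal.ofReal (2 / 3) + ENNReal.ofReal (1 / 12) = ENNReal.ofReal (3 / 4) := by
    rw [← ENNReal.ofReal_add (by norm_num) (by norm_num)]
    norm_num
  refine (ENNReal.add_le_add_iff_right (a := ENNReal.ofReal (3 / 4)) ENNReal.ofReal_ne_top).1 ?_
  rw [← h4, ← h5]
  exact h1.trans (add_le_add_right (add_le_add hrev hcol) _)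

end DataSets

/-! ### Both signs give the same averaged data law, and the two-point argument -/

section Indistinguishability

variable {K N : ℕ}

theorem rewardFn_congr (x : State K N) (a : Fin 2) (h : x.2.isRight ∨ x.1 ≠ Fin.last K ∨ a ≠ 0) :
    rewardFn true x a = rewardFn false x a := by
  obtain ⟨l, o | z⟩ := x
  · rcases h with h | h | h
    · simp at h
    · have h' : l ≠ Fin.last K := h
      simp [rewardFn, h']
    · simp [rewardFn, valueFn, h]
  · simp [rewardFn, valueFn]

/-- The exit rates match: `slip` comes from the action in good observations and from the transition
in bad ones. This is why the behavior policy uses the same constant as the chain. -/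
theorem slip_mul_mixWeight_one (m : ℝ) (z : Fin 3) :
    ENNReal.ofReal (slip K) * ENNReal.ofReal (mixWeight N 1 m (Sum.inr z)) =
      ENNReal.ofReal (mixWeight N (slip K) m (Sum.inr z)) := by
  rw [← ENNReal.ofReal_mul (slip_pos K).le]
  congr 1
  fin_cases z <;> simp [mixWeight] <;> ring

variable [NeZero N]

/-- The probability of a step of a trajectory, as a function of the sign and of the label of the
current state. -/
def stepFactor (s : Bool) (τ : Trajectory (State K N) (Fin 2) (K + 1)) (h : Fin (K + 1))
    (ℓ : Bool) : ℝ≥0∞ :=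
  behaviorLaw K ℓ (τ h).2.1 * PMF.pure (rewardFn s (τ h).1 (τ h).2.1) (τ h).2.2 *
    if hh : (h : ℕ) + 1 < K + 1 then
      (if (τ ⟨h + 1, hh⟩).1.1 = nextLayer (τ h).1.1 then
        kindLaw s ℓ (τ h).1 (τ h).2.1 (τ ⟨h + 1, hh⟩).1.2 else 0)
    else 1

theorem dataLaw_apply (s : Bool) (θ : Fin (K + 1) × Fin N → Bool)
    (τ : Trajectory (State K N) (Fin 2) (K + 1)) :
    dataLaw s θ τ = (mdp s θ).init (τ 0).1 *
      ∏ h, stepFactor s τ h (label (τ h).1 (θ (key (τ h).1))) := by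
  rw [dataLaw, MDP.trajectoryLaw_apply]
  simp only [MDP.stepWeight, trans_apply]
  rfl

/-- Exchanging the two signs amounts to exchanging the two labels. -/
theorem behaviorLaw_mul_kindLaw_sum (x : State K N) (a : Fin 2) (κ : Kind N) :
    behaviorLaw K true a * kindLaw true true x a κ +
        behaviorLaw K false a * kindLaw true false x a κ =
      behaviorLaw K true a * kindLaw false true x a κ +
        behaviorLaw K false a * kindLaw false false x a κ := by
  obtain ⟨l, o | z⟩ := x
  · by_cases ha : a = 0
    · subst ha
      simp only [kindLaw, if_true, mixLaw_apply, behaviorLaw_true_zero, behaviorLaw_false_zero,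
        Bool.false_eq_true, if_false, one_mul]
      rcases κ with o' | z
      · simp [mixWeight]
      · rw [slip_mul_mixWeight_one, slip_mul_mixWeight_one]
        simp only [Bool.xor_true, Bool.xor_false, Bool.not_true, Bool.not_false]
        rw [add_comm]
    · simp [kindLaw, ha]
  · simp [kindLaw]

/-- Without revelation the reward factor is free of the sign and of the label, and
`behaviorLaw_mul_kindLaw_sum` handles the rest. -/
theorem stepFactor_sum (τ : Trajectory (State K N) (Fin 2) (K + 1)) (hlay : Layered τ)
    (hrev : ¬ Revealing τ) (h : Fin (K + 1)) (hobs : (τ h).1.2.isLeft) :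
    stepFactor true τ h true + stepFactor true τ h false =
      stepFactor false τ h true + stepFactor false τ h false := by
  have hlast : (τ h).1.1 ≠ Fin.last K ∨ (τ h).2.1 ≠ 0 := by
    by_contra hcon
    push Not at hcon
    have hh : h = Fin.last K := (hlay h).symm.trans hcon.1
    subst hh
    exact hrev ⟨hobs, hcon.2⟩
  unfold stepFactor
  rw [rewardFn_congr _ _ (Or.inr hlast)]
  split_ifs
  · have := behaviorLaw_mul_kindLaw_sum (τ h).1 (τ h).2.1 (τ ⟨h + 1, ‹_›⟩).1.2
    simp only [mul_right_comm _ (PMF.pure _ _), ← add_mul]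
    rw [this]
  · rfl
  · rfl

/-- The hidden bits enter through labels only, and the visits to observations read distinct bits, so
`sum_prod_comp_eq` reduces the claim to single steps. -/
theorem sum_prod_dataLaw_eq {n : ℕ} (D : Fin n → Trajectory (State K N) (Fin 2) (K + 1))
    (hD : Uninformative D) :
    ∑ θ : Fin (K + 1) × Fin N → Bool, ∏ i, dataLaw true θ (D i) =
      ∑ θ : Fin (K + 1) × Fin N → Bool, ∏ i, dataLaw false θ (D i) := by
  have hinit : ∀ s θ (x : State K N), (mdp s θ).init x = (mdp true fun _ => true).init x :=
    fun s θ x => rfl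
  simp_rw [dataLaw_apply, Finset.prod_mul_distrib, hinit, ← Finset.mul_sum]
  congr 1
  simp_rw [← Fintype.prod_prod_type' fun i h => stepFactor _ (D i) h (label (D i h).1 _)]
  refine sum_prod_comp_eq (Finset.univ.filter fun p : Fin n × Fin (K + 1) => (D p.1 p.2).1.2.isLeft)
    (fun p => key (D p.1 p.2).1)
    ?_ (fun p t => stepFactor true (D p.1) p.2 (label (D p.1 p.2).1 t))
    (fun p t => stepFactor false (D p.1) p.2 (label (D p.1 p.2).1 t)) ?_ ?_
  -- Equal keys lie in one layer, hence at one time, as trajectories are layered; distinct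
  -- trajectories do not share a pair.
  · rintro ⟨i, h⟩ hp ⟨i', h'⟩ hp' heq
    have hp1 : (D i h).1.2.isLeft := by simpa using hp
    have hp2 : (D i' h').1.2.isLeft := by simpa using hp'
    have hh : h = h' := by
      rw [← hD.layered i h, ← hD.layered i' h']
      have heq' : key (D i h).1 = key (D i' h').1 := heq
      exact (Prod.ext_iff.1 heq').1
    subst hh
    by_contra hne
    have hi : i ≠ i' := fun hi => hne (by rw [hi])
    obtain ⟨o, ho⟩ := Sum.isLeft_iff.1 hp1
    obtain ⟨o', ho'⟩ := Sum.isLeft_iff.1 hp2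
    have hoo : o.1 = o'.1 := by
      have := congrArg Prod.snd heq
      simpa [key, ho, ho'] using this
    exact hD.no_collision i i' h o.1 hi (by simp [pairIndex, ho]) (by simp [pairIndex, ho', hoo])
  · rintro ⟨i, h⟩ hp
    have hp1 : (D i h).1.2.isLeft := by simpa using hp
    obtain ⟨o, ho⟩ := Sum.isLeft_iff.1 hp1
    simp only [label, ho]
    simp_rw [Bool.xor_comm o.2]
    rw [sum_xor, sum_xor]
    exact stepFactor_sum (D i) (hD.layered i) (hD.not_revealing i) h hp1
  -- In terminal states neither the sign nor the bit matters.
  · rintro ⟨i, h⟩ hp b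
    have hp1 : (D i h).1.2.isRight := by simpa using hp
    obtain ⟨z, hz⟩ := Sum.isRight_iff.1 hp1
    simp only [label, hz]
    refine ⟨?_, trivial⟩
    unfold stepFactor
    rw [rewardFn_congr _ _ (Or.inl hp1)]
    simp [kindLaw, hz]

theorem ofReal_abs_sub_le_lintegral (μ : MeasureTheory.ProbabilityMeasure ℝ) (a b : ℝ) :
    ENNReal.ofReal |a - b| ≤ ∫⁻ v, ENNReal.ofReal |v - a| ∂(μ : MeasureTheory.Measure ℝ) +
      ∫⁻ v, ENNReal.ofReal |v - b| ∂(μ : MeasureTheory.Measure ℝ) := by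
  rw [← MeasureTheory.lintegral_add_left (by fun_prop)]
  calc ENNReal.ofReal |a - b|
      = ∫⁻ _v, ENNReal.ofReal |a - b| ∂(μ : MeasureTheory.Measure ℝ) := by simp
    _ ≤ _ := by
        refine MeasureTheory.lintegral_mono fun v => ?_
        rw [← ENNReal.ofReal_add (abs_nonneg _) (abs_nonneg _)]
        refine ENNReal.ofReal_le_ofReal ?_
        rw [abs_sub_comm v a]
        exact abs_sub_le a v b

/-- No algorithm with few trajectories is accurate on all hard problems. -/
theorem le_two_mul_error {n : ℕ} (alg : OPEAlgorithm (State K N) (Fin 2) (K + 1) n)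
    (E : ℝ≥0∞) (hE : ∀ s θ, (problem s θ).expectedError alg ≤ E) (hn : n ≤ 2 ^ K)
    (hN : 12 * (n * n * (K + 1)) ≤ N) :
    ENNReal.ofReal (1 / 6) ≤ E + E := by
  classical
  -- All problems share the evaluation policy and the function class, so the law of the estimate
  -- depends on the data alone.
  let err : (Fin n → Trajectory (State K N) (Fin 2) (K + 1)) → Bool → ℝ≥0∞ := fun D s =>
    ∫⁻ v, ENNReal.ofReal |v - sgn s * (1 / 3)|
      ∂(alg (fun _ => 0) {valueFn true, valueFn false} D : MeasureTheory.Measure ℝ)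
  let Θ : Type := Fin (K + 1) × Fin N → Bool
  have herr : ∀ D, ENNReal.ofReal (2 / 3) ≤ err D true + err D false := fun D => by
    refine le_trans (le_of_eq ?_) (ofReal_abs_sub_le_lintegral _ _ _)
    congr 1
    norm_num [sgn, abs_of_pos]
  have hexp : ∀ s (θ : Θ), (problem s θ).expectedError alg =
      ∑' D : Fin n → Trajectory (State K N) (Fin 2) (K + 1),
        (∏ i, dataLaw s θ (D i)) * err D s := fun s θ => by
    have ht : (problem s θ).target = sgn s * (1 / 3) := value_eq s θ
    simp only [OPEProblem.expectedError, ht]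
    rfl
  -- On uninformative data the mixture over `θ` with sign `true` may stand in for either sign, so
  -- one weight serves both errors.
  have hsum : ∀ s, ∑' D : Fin n → Trajectory (State K N) (Fin 2) (K + 1),
      (if Uninformative D then (∑ θ : Θ, ∏ i, dataLaw true θ (D i)) * err D s else 0) ≤
      Fintype.card Θ * E := fun s => by
    calc _ ≤ ∑' D : Fin n → Trajectory (State K N) (Fin 2) (K + 1),
          (∑ θ : Θ, ∏ i, dataLaw s θ (D i)) * err D s := by
          refine ENNReal.tsum_le_tsum fun D => ?_
          split_ifs with hD
          · cases s
            · rw [sum_prod_dataLaw_eq D hD]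
            · exact le_rfl
          · exact zero_le
      _ = ∑ θ : Θ, (problem s θ).expectedError alg := by
          simp_rw [hexp, Finset.sum_mul]
          rw [Summable.tsum_finsetSum fun _ _ => ENNReal.summable]
      _ ≤ ∑ _θ : Θ, E := Finset.sum_le_sum fun θ _ => hE s θ
      _ = _ := by rw [Finset.sum_const, Finset.card_univ, nsmul_eq_mul]
  have hmass : (Fintype.card Θ : ℝ≥0∞) * ENNReal.ofReal (1 / 4) ≤
      ∑' D : Fin n → Trajectory (State K N) (Fin 2) (K + 1),
        (if Uninformative D then ∑ θ : Θ, ∏ i, dataLaw true θ (D i) else 0) := by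
    calc _ = ∑ _θ : Θ, ENNReal.ofReal (1 / 4) := by
          rw [Finset.sum_const, Finset.card_univ, nsmul_eq_mul]
      _ ≤ ∑ θ : Θ, ∑' D : Fin n → Trajectory (State K N) (Fin 2) (K + 1),
            (∏ i, dataLaw true θ (D i)) * (if Uninformative D then 1 else 0) :=
          Finset.sum_le_sum fun θ _ => quarter_le_tsum_uninformative true θ hn hN
      _ = _ := by
          rw [← Summable.tsum_finsetSum fun _ _ => ENNReal.summable]
          refine tsum_congr fun D => ?_
          rw [← Finset.sum_mul]
          split_ifs <;> simp
  have hcard0 : (Fintype.card Θ : ℝ≥0∞) ≠ 0 := by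
    simp [Θ]
  have hfinal : (Fintype.card Θ : ℝ≥0∞) * ENNReal.ofReal (1 / 6) ≤ Fintype.card Θ * (E + E) := by
    calc (Fintype.card Θ : ℝ≥0∞) * ENNReal.ofReal (1 / 6)
        = Fintype.card Θ * ENNReal.ofReal (1 / 4) * ENNReal.ofReal (2 / 3) := by
          rw [mul_assoc, ← ENNReal.ofReal_mul (by norm_num)]
          norm_num
      _ ≤ (∑' D : Fin n → Trajectory (State K N) (Fin 2) (K + 1),
            (if Uninformative D then ∑ θ : Θ, ∏ i, dataLaw true θ (D i) else 0)) *
              ENNReal.ofReal (2 / 3) := by gcongr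
      _ ≤ ∑' D : Fin n → Trajectory (State K N) (Fin 2) (K + 1),
            ((if Uninformative D then (∑ θ : Θ, ∏ i, dataLaw true θ (D i)) * err D true else 0) +
              if Uninformative D then (∑ θ : Θ, ∏ i, dataLaw true θ (D i)) * err D false
              else 0) := by
          rw [← ENNReal.tsum_mul_right]
          refine ENNReal.tsum_le_tsum fun D => ?_
          split_ifs
          · rw [← mul_add]
            exact mul_le_mul_right (herr D) _
          · simp
      _ ≤ Fintype.card Θ * E + Fintype.card Θ * E := by
          rw [ENNReal.tsum_add]
          exact add_le_add (hsum true) (hsum false)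
      _ = _ := (mul_add _ _ _).symm
  exact (ENNReal.mul_le_mul_iff_right hcard0 (ENNReal.natCast_ne_top _)).1 hfinal

/-- The rate 1/2 absorbs the shift from H to K = H - 1: (K + 1)/2 ≤ K for K ≥ 1, and for K = 0 an
integer below √2 is at most 1. -/
theorem le_two_pow_of_lt_rpow {n : ℕ} (h : (n : ℝ) < (2 : ℝ) ^ ((1 / 2 : ℝ) * ((K + 1 : ℕ) : ℝ))) :
    n ≤ 2 ^ K := by
  rcases Nat.eq_zero_or_pos K with rfl | hK
  · have h1 : (2 : ℝ) ^ ((1 / 2 : ℝ) * ((0 + 1 : ℕ) : ℝ)) < 2 ^ (1 : ℝ) :=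
      Real.rpow_lt_rpow_of_exponent_lt (by norm_num) (by norm_num)
    rw [Real.rpow_one] at h1
    have h2 : n < 2 := by exact_mod_cast h.trans h1
    simpa using Nat.lt_succ_iff.1 h2
  · have h1 : (2 : ℝ) ^ ((1 / 2 : ℝ) * ((K + 1 : ℕ) : ℝ)) ≤ 2 ^ (K : ℝ) := by
      refine Real.rpow_le_rpow_of_exponent_le (by norm_num) ?_
      have : (1 : ℝ) ≤ K := by exact_mod_cast hK
      push_cast
      linarith
    rw [Real.rpow_natCast] at h1
    exact_mod_cast (h.le.trans h1)

end Indistinguishability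

end HardInstance

end OfflineRL

end

/-! ### Assembly of the lower bound -/

theorem mainTheorem1 :
    ∃ C c : ℝ, 0 < C ∧ 0 < c ∧
      ∀ (ε : ℝ) (H : ℕ), 0 < ε → ε ≤ 1 / 15 → 1 ≤ H →
        ∃ (X : Type) (_ : Finite X) (layer : X → Fin H)
          (G : Set (OfflineRL.OPEProblem X (Fin 2) H layer)),
          (∀ g ∈ G,
            g.Realizable ∧
            (∀ x, g.evalPolicy x = 0) ∧
            g.funClass.ncard = 2 ∧
            g.concentrability ≤ ENNReal.ofReal (C * (H : ℝ) ^ 3)) ∧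
          ∀ (n : ℕ) (alg : OfflineRL.OPEAlgorithm X (Fin 2) H n),
            (∀ g ∈ G, g.expectedError alg ≤ ENNReal.ofReal (ε / (16 * (H : ℝ)))) →
            (2 : ℝ) ^ (c * (H : ℝ)) ≤ (n : ℝ) := by
  -- `3` works because 2H + 1 ≤ 3H ≤ 3H³.
  refine ⟨3, 1 / 2, by norm_num, by norm_num, fun ε H hε0 hε hH => ?_⟩
  obtain ⟨K, rfl⟩ := Nat.exists_eq_add_of_le' hH
  -- The class is fixed before `n`, so `N` must suit every n ≤ 2^K.
  let N : ℕ := 12 * (2 ^ K * 2 ^ K * (K + 1))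
  have : NeZero N := ⟨by positivity⟩
  refine ⟨OfflineRL.HardInstance.State K N, inferInstance, Prod.fst,
    {g | ∃ s θ, g = OfflineRL.HardInstance.problem s θ}, ?_, fun n alg hE => ?_⟩
  · rintro g ⟨s, θ, rfl⟩
    refine ⟨OfflineRL.HardInstance.realizable_problem s θ, fun _ => rfl,
      Set.ncard_pair OfflineRL.HardInstance.valueFn_ne,
      (OfflineRL.HardInstance.concentrability_problem_le s θ).trans
        (ENNReal.ofReal_le_ofReal ?_)⟩
    have h1 : (1 : ℝ) ≤ ((K + 1 : ℕ) : ℝ) := by exact_mod_cast hH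
    have h2 : ((K + 1 : ℕ) : ℝ) ≤ ((K + 1 : ℕ) : ℝ) ^ 3 := le_self_pow₀ h1 (by norm_num)
    have h3 : ((K + 1 : ℕ) : ℝ) = (K : ℝ) + 1 := by push_cast; ring
    rw [h3] at h1 h2 ⊢
    linarith
  · by_contra hlt
    have hn : n ≤ 2 ^ K := OfflineRL.HardInstance.le_two_pow_of_lt_rpow (not_le.1 hlt)
    have hN : 12 * (n * n * (K + 1)) ≤ N := by
      simp only [N]
      gcongr
    have h1 := OfflineRL.HardInstance.le_two_mul_error alg _
      (fun s θ => hE _ ⟨s, θ, rfl⟩) hn hN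
    have h2 : (0 : ℝ) ≤ ε / (16 * ((K + 1 : ℕ) : ℝ)) := by positivity
    rw [← ENNReal.ofReal_add h2 h2, ENNReal.ofReal_le_ofReal_iff (add_nonneg h2 h2)] at h1
    -- Twice this bound is 1/120, which contradicts the lower bound 1/6 in `h1`.
    have h3 : ε / (16 * ((K + 1 : ℕ) : ℝ)) ≤ (1 / 15) / 16 := by
      have h4 : (1 : ℝ) ≤ ((K + 1 : ℕ) : ℝ) := by exact_mod_cast hH
      exact div_le_div₀ (by norm_num) hε (by norm_num) (by linarith)
    linarith
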